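/- Let $\Bbbk$ be a field of characteristic $0$ and $g$ a natural number. A point of size $s$ is a tuple $Y=(Y_1,\dots,Y_g)\in M_s(\Bbbk)^g$; for $S\in M_s(\Bbbk)$ and $Z\in M_s(\Bbbk)^g$ write $SZ=(SZ_j)_j$, $ZS=(Z_jS)_j$, $[S,Y]=(SY_j-Y_jS)_j$, and let $\mathcal C(Y)=\{S: [S,Y]=0\}$. A point is irreducible if its matrices have no nontrivial common invariant subspace (and $s\ge1$), and semisimple if it is similar (under simultaneous conjugation by an invertible matrix) to a direct sum of irreducible points, its irreducible blocks. Semisimple points $Y^1,\dots,Y^h$ are separated if for $i\ne j$ no irreducible block of $Y^i$ is similar to an irreducible block of $Y^j$. A sequence $(f_\ell)_{\ell=0}^L$ of $\ell$-linear maps $f_\ell:(M_s(\Bbbk)^g)^\ell\to M_s(\Bbbk)$ satisfies $\mathrm{LAC}_L(Y)$ if $f_1([S,Y])=[S,f_0]$ (when $L\ge1$) and, for $2\le\ell\le L$, $1\le j\le \ell-2$, all $S\in M_s(\Bbbk)$ and all $Z^1,\dots,Z^{\ell-1}\in M_s(\Bbbk)^g$, \begin{align*} f_\ell([S,Y],Z^1,\dots,Z^{\ell-1})&=Sf_{\ell-1}(Z^1,\dots,Z^{\ell-1})-f_{\ell-1}(SZ^1,Z^2,\dots,Z^{\ell-1}),\\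 f_\ell(\dots,Z^j,[S,Y],Z^{j+1},\dots)&=f_{\ell-1}(\dots,Z^jS,Z^{j+1},\dots)-f_{\ell-1}(\dots,Z^j,SZ^{j+1},\dots),\\ f_\ell(Z^1,\dots,Z^{\ell-1},[S,Y])&=f_{\ell-1}(Z^1,\dots,Z^{\ell-2},Z^{\ell-1}S)-f_{\ell-1}(Z^1,\dots,Z^{\ell-1})S, \end{align*} and moreover for all $S\in\mathcal C(Y)$ and $Z^1,\dots,Z^L\in M_s(\Bbbk)^g$: if $L\ge1$, then $Sf_L(Z^1,\dots,Z^L)=f_L(SZ^1,Z^2,\dots,Z^L)$, $f_L(\dots,Z^jS,Z^{j+1},\dots)=f_L(\dots,Z^j,SZ^{j+1},\dots)$ for $1\le j\le L-1$, and $f_L(Z^1,\dots,Z^{L-1},Z^LS)=f_L(Z^1,\dots,Z^L)S$; if $L=0$, then $[S,f_0]=0$. An nc set is a graded set $\Omega=\bigsqcup_n\Omega_n$ with $\Omega_n\subseteq M_n(\Bbbk)^g$ that is closed under direct sums; it is (right) admissible if for all $X\in\Omega_m$, $X'\in\Omega_n$, $Z\in(\Bbbk^{m\times n})^g$ there is $\alpha\in\Bbbk\setminus\{0\}$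 with $\begin{pmatrix}X&\alpha Z\\0&X'\end{pmatrix}\in\Omega_{m+n}$. An nc function on $\Omega$ is a map $f$ with $f(\Omega_n)\subseteq M_n(\Bbbk)$ that respects direct sums and similarities. If $\Omega$ is admissible and $Y\in\Omega_s$, the $\ell$-th nc differential of $f$ at $Y$ is the $\ell$-linear map $\Delta^\ell_Yf:(M_s(\Bbbk)^g)^\ell\to M_s(\Bbbk)$ such that $\Delta_Y^\ell f(Z^1,\dots,Z^\ell)$ is the upper right $s\times s$ block of $f(X)$ whenever the $(\ell+1)\times(\ell+1)$ block matrix tuple $X$ with diagonal blocks $Y$, superdiagonal blocks $Z^1,\dots,Z^\ell$ and zero blocks elsewhere lies in $\Omega$; $\Delta^0_Yf=f(Y)$. An nc polynomial, i.e. an element of the free algebra $\Bbbk\langle x_1,\dots,x_g\rangle$, is an nc function on all of $\bigsqcup_nM_n(\Bbbk)^g$. Theorem (free Hermite interpolation). (1) Let $Y^i\in M_{s_i}(\Bbbk)^g$, $1\le i\le h$, be separated semisimple points and $L\ge0$. For each $i$ let $(f^{(i)}_\ell)_{\ell=0}^L$ be a sequence of $\ell$-linear maps $f^{(i)}_\ell:(M_{s_i}(\Bbbk)^g)^\ell\to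 M_{s_i}(\Bbbk)$ satisfying $\mathrm{LAC}_L(Y^i)$. Then there is an nc polynomial $p$ such that $\Delta^\ell_{Y^i}p=f^{(i)}_\ell$ for all $1\le i\le h$ and $0\le\ell\le L$. (2) Let $f$ be an nc function on an admissible nc set $\Omega$, let $Y^1,\dots,Y^h\in\Omega$ be semisimple points (not necessarily separated), and $L\ge0$. Then there is an nc polynomial $p$ such that the nc differentials of $f$ and $p$ at these points exist and agree up to order $L$: $\Delta^\ell_{Y^i}p=\Delta^\ell_{Y^i}f$ for all $1\le i\le h$ and $0\le\ell\le L$. -/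

import Mathlib

namespace FreeNC

/-- A point of size `n` of the nc space over `k^g`: a `g`-tuple of `n × n` matrices. -/
abbrev Point (k : Type*) (g n : ℕ) : Type _ := Fin g → Matrix (Fin n) (Fin n) k

section Algebra

variable {k : Type*} [Field k] {g : ℕ}

/-- `S Z = (S Z_1, …, S Z_g)`. -/
def lmul {n : ℕ} (S : Matrix (Fin n) (Fin n) k) (Z : Point k g n) : Point k g n :=
  fun j => S * Z j

/-- `Z S = (Z_1 S, …, Z_g S)`. -/
def rmul {n : ℕ} (Z : Point k g n) (S : Matrix (Fin n) (Fin n) k) : Point k g n :=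
  fun j => Z j * S

/-- `[S, Y] = (S Y_1 - Y_1 S, …, S Y_g - Y_g S)`. -/
def bracket {n : ℕ} (S : Matrix (Fin n) (Fin n) k) (Y : Point k g n) : Point k g n :=
  fun j => S * Y j - Y j * S

/-! ### Irreducible, semisimple and separated points -/

/-- Similarity of tuples of matrices `Y' = P Y P⁻¹` with `P` invertible. The index types of `Y`
and `Y'` are identified through a bijection `e` (any other choice of `e` changes `P` by a
permutation matrix); in particular similar points have the same size. -/
def Similar {ι ι' : Type} [Fintype ι'] [DecidableEq ι']
    (Y : Fin g → Matrix ι ι k) (Y' : Fin g → Matrix ι' ι' k) : Prop :=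
  ∃ (e : ι ≃ ι') (P : (Matrix ι' ι' k)ˣ), ∀ j,
    Y' j = (P : Matrix ι' ι' k) * Matrix.reindex e e (Y j) * ((P⁻¹ : (Matrix ι' ι' k)ˣ) : Matrix ι' ι' k)

/-- A point of positive size without nontrivial common invariant subspaces. -/
def IsIrreduciblePoint {s : ℕ} (Y : Point k g s) : Prop :=
  0 < s ∧ ∀ W : Submodule k (Fin s → k),
    (∀ j, ∀ v ∈ W, (Y j).mulVec v ∈ W) → W = ⊥ ∨ W = ⊤

/-- `Y` is similar to the direct sum `B_1 ⊕ ⋯ ⊕ B_r` and every `B_a` is irreducible; the `B_a` are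
then the irreducible blocks of `Y`. -/
def IsIrredDecomp {s : ℕ} (Y : Point k g s) {r : ℕ} {n : Fin r → ℕ}
    (B : ∀ a, Point k g (n a)) : Prop :=
  (∀ a, IsIrreduciblePoint (B a)) ∧
    Similar (fun j => Matrix.blockDiagonal' fun a => B a j) Y

/-- A point is semisimple if it is similar to a direct sum of irreducible points. -/
def IsSemisimplePoint {s : ℕ} (Y : Point k g s) : Prop :=
  ∃ (r : ℕ) (n : Fin r → ℕ) (B : ∀ a, Point k g (n a)), IsIrredDecomp Y B

/-- For different `i`, `i'`, no irreducible block of `Y i` is similar to one of `Y i'`. -/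
def Separated {h : ℕ} {s : Fin h → ℕ} (Y : ∀ i, Point k g (s i)) : Prop :=
  ∀ i i', i ≠ i' →
    ∀ (r r' : ℕ) (n : Fin r → ℕ) (n' : Fin r' → ℕ)
      (B : ∀ a, Point k g (n a)) (B' : ∀ a, Point k g (n' a)),
      IsIrredDecomp (Y i) B → IsIrredDecomp (Y i') B' → ∀ a a', ¬ Similar (B a) (B' a')

/-! ### Linear compatibility conditions -/

/-- `ℓ`-linear maps `(M_s(k)^g)^ℓ → M_s(k)`. -/
abbrev MultiMap (k : Type*) [Field k] (g s ℓ : ℕ) : Type _ :=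
  MultilinearMap k (fun _ : Fin ℓ => Point k g s) (Matrix (Fin s) (Fin s) k)

/-- Multiplication by `S` from the right of what stands before the gap `t` in
`f (Z^1, …, Z^m)`: this is `S f (Z^1, …, Z^m)` for the gap `0` in front of `Z^1`,
and `f (…, Z^j S, Z^(j+1), …)` for the gap just after `Z^j`. -/
def gapLeft {s m : ℕ} (f : MultiMap k g s m) (t : Fin (m + 1)) (S : Matrix (Fin s) (Fin s) k)
    (Z : Fin m → Point k g s) : Matrix (Fin s) (Fin s) k :=
  Fin.cases (motive := fun _ => Matrix (Fin s) (Fin s) k) (S * f Z)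
    (fun j => f (Function.update Z j (rmul (Z j) S))) t

/-- Multiplication by `S` from the left of what stands after the gap `t` in
`f (Z^1, …, Z^m)`: this is `f (Z^1, …, Z^m) S` for the gap after `Z^m`,
and `f (…, Z^j, S Z^(j+1), …)` for the gap just before `Z^(j+1)`. -/
def gapRight {s m : ℕ} (f : MultiMap k g s m) (t : Fin (m + 1)) (S : Matrix (Fin s) (Fin s) k)
    (Z : Fin m → Point k g s) : Matrix (Fin s) (Fin s) k :=
  Fin.lastCases (motive := fun _ => Matrix (Fin s) (Fin s) k) (f Z * S)
    (fun j => f (Function.update Z j (lmul S (Z j)))) t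

/-- The truncated linear compatibility conditions of order `L` at `Y`; they involve only
`F 0, …, F L`. The first part has `[S, Y]` at position `t` among the arguments of `F (m + 1)`:
for `m = 0` it is `F 1 [S, Y] = [S, F 0]`, and for `m ≥ 1` it consists of the three equations with
`[S, Y]` as the first, a middle, and the last argument. The second part is the invariance of `F L`
under the centralizer of `Y`; for `L = 0` it says that `F 0` commutes with the centralizer. -/
def TruncLAC {s : ℕ} (Y : Point k g s) (L : ℕ) (F : ∀ ℓ : ℕ, MultiMap k g s ℓ) : Prop :=
  (∀ m, m < L → ∀ (t : Fin (m + 1)) (S : Matrix (Fin s) (Fin s) k) (Z : Fin m → Point k g s),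
    F (m + 1) (Fin.insertNth (α := fun _ => Point k g s) t (bracket S Y) Z)
      = gapLeft (F m) t S Z - gapRight (F m) t S Z) ∧
  (∀ (t : Fin (L + 1)) (S : Matrix (Fin s) (Fin s) k), (∀ j, S * Y j = Y j * S) →
    ∀ Z : Fin L → Point k g s, gapLeft (F L) t S Z = gapRight (F L) t S Z)

/-! ### Noncommutative functions and their differentials -/

/-- The block upper triangular point `(X, Z; 0, Y)` of size `m + n`. -/
def upperBlock {m n : ℕ} (X : Point k g m) (Z : Fin g → Matrix (Fin m) (Fin n) k)
    (Y : Point k g n) : Point k g (m + n) :=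
  fun j => Matrix.reindex finSumFinEquiv finSumFinEquiv (Matrix.fromBlocks (X j) (Z j) 0 (Y j))

/-- The direct sum `A ⊕ B` of two square matrices. -/
def directSum {m n : ℕ} (A : Matrix (Fin m) (Fin m) k) (B : Matrix (Fin n) (Fin n) k) :
    Matrix (Fin (m + n)) (Fin (m + n)) k :=
  Matrix.reindex finSumFinEquiv finSumFinEquiv (Matrix.fromBlocks A 0 0 B)

/-- A graded subset of the nc space, closed under direct sums. -/
def IsNCSet (Ω : ∀ n : ℕ, Set (Point k g n)) : Prop :=
  ∀ (m n : ℕ) (X : Point k g m) (Y : Point k g n), X ∈ Ω m → Y ∈ Ω n →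
    (fun j => directSum (X j) (Y j)) ∈ Ω (m + n)

/-- Right admissibility of a graded subset of the nc space. -/
def IsRightAdmissible (Ω : ∀ n : ℕ, Set (Point k g n)) : Prop :=
  ∀ (m n : ℕ) (X : Point k g m) (Y : Point k g n) (Z : Fin g → Matrix (Fin m) (Fin n) k),
    X ∈ Ω m → Y ∈ Ω n → ∃ α : k, α ≠ 0 ∧ upperBlock X (α • Z) Y ∈ Ω (m + n)

/-- `f` is an nc function on `Ω`: graded (by its type), it respects direct sums and similarities.
Only the values of `f` on `Ω` matter. -/
structure IsNCFunction (Ω : ∀ n : ℕ, Set (Point k g n))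
    (f : ∀ n : ℕ, Point k g n → Matrix (Fin n) (Fin n) k) : Prop where
  map_directSum : ∀ (m n : ℕ) (X : Point k g m) (Y : Point k g n), X ∈ Ω m → Y ∈ Ω n →
    f (m + n) (fun j => directSum (X j) (Y j)) = directSum (f m X) (f n Y)
  map_similar : ∀ (n : ℕ) (X : Point k g n) (P : (Matrix (Fin n) (Fin n) k)ˣ), X ∈ Ω n →
    (fun j => P.val * X j * P.inv) ∈ Ω n →
    f n (fun j => P.val * X j * P.inv) = P.val * f n X * P.inv

/-- The nc function given by evaluation of an nc polynomial (an element of the free algebra). -/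
def evalPoly (p : FreeAlgebra k (Fin g)) (n : ℕ) (X : Point k g n) : Matrix (Fin n) (Fin n) k :=
  FreeAlgebra.lift k X p

/-- The block bidiagonal point of size `(ℓ + 1) s` with `Y` in the diagonal blocks and
`Z^1, …, Z^ℓ` in the blocks directly above the diagonal. -/
def bidiag {s ℓ : ℕ} (Y : Point k g s) (Z : Fin ℓ → Point k g s) : Point k g ((ℓ + 1) * s) :=
  fun j => Matrix.reindex finProdFinEquiv finProdFinEquiv
    (Matrix.of fun (a b : Fin (ℓ + 1) × Fin s) =>
      if a.1 = b.1 then Y j a.2 b.2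
      else if hb : a.1.val + 1 = b.1.val then
        Z ⟨a.1.val, by have := b.1.isLt; omega⟩ j a.2 b.2
      else 0)

/-- The upper right `s × s` block of a matrix of size `(ℓ + 1) s`. -/
def topRight {s ℓ : ℕ} (M : Matrix (Fin ((ℓ + 1) * s)) (Fin ((ℓ + 1) * s)) k) :
    Matrix (Fin s) (Fin s) k :=
  Matrix.of fun a b => M (finProdFinEquiv ((0 : Fin (ℓ + 1)), a)) (finProdFinEquiv (Fin.last ℓ, b))

/-- The `ℓ`-linear map `T` is the `ℓ`-th nc differential `Δ^ℓ_Y f` of `f` at `Y`: for all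
`Z^1, …, Z^ℓ` such that the block bidiagonal point `X` with diagonal `Y` and superdiagonal
`Z^1, …, Z^ℓ` lies in `Ω`, the upper right block of `f(X)` is `T (Z^1, …, Z^ℓ)`. If `Ω` is right
admissible and `Y ∈ Ω`, then every `(Z^1, …, Z^ℓ)` satisfies this after multiplying each `Z^i` by a
nonzero scalar, so at most one multilinear `T` has this property. For `ℓ = 0` it is `f(Y)`. -/
def IsNCDifferential (Ω : ∀ n : ℕ, Set (Point k g n))
    (f : ∀ n : ℕ, Point k g n → Matrix (Fin n) (Fin n) k)
    {s ℓ : ℕ} (Y : Point k g s) (T : MultiMap k g s ℓ) : Prop :=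
  ∀ Z : Fin ℓ → Point k g s, bidiag Y Z ∈ Ω ((ℓ + 1) * s) →
    topRight (f ((ℓ + 1) * s) (bidiag Y Z)) = T Z

end Algebra

end FreeNC

/-!
For fixed `Y`, the Leibniz rule for multiplication by `x_j` turns the sequences of multilinear maps
into a module over the free algebra, in which the differentials of `p` at `Y` are `p` applied to
those of `1`.

One point, by induction on the order: subtracting a polynomial that is correct to lower order leaves
a map `G` of order `m` that vanishes on brackets with `Y` and is balanced over the centralizer of
`Y`. To realize `G` as the leading coefficient of a polynomial of vanishing order `m`, it suffices,
by semisimplicity, that `G` satisfies every linear relation satisfied by all these leading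
coefficients. Such a relation is reduced to order `m - 1` by peeling off the first argument: it
forces the vectors of coefficients of order `m - 1` to span a semisimple submodule of a first-order
deformation of the module of `Y`, and splitting this submodule yields matrices `P_li` in the
centralizer with `∑ l, Z_l P_li = [τ_i, Y]`. Moving them across the first gap turns the relation
into one between values of `G` at brackets, which are zero.

Several points: the modules of separated semisimple points have no nonzero homomorphisms between
them, so some polynomial has value `1` at one point and `0` at the others, and a power trick
improves this to any finite order.

For an nc function `f`, admissibility makes every invariant subspace of a bidiagonal point over a
semisimple `Y` the kernel of an intertwiner into a point of `Ω`. Since `f` respects intertwiners,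
`f(X) v` lies in the submodule generated by `v`, so that `f` agrees with a polynomial at any
finitely many pairs `(X, v)`, and by finite-dimensionality in all differentials up to order `L` at
once.
-/

namespace FreeNC

section Action

variable {k σ W W' : Type*} [Field k] [AddCommGroup W] [Module k W] [AddCommGroup W'] [Module k W']

/-- The action of noncommutative polynomials on a space with a tuple of endomorphisms `X`, each
variable `x_j` acting as `X j`. -/
noncomputable def act (X : σ → Module.End k W) : FreeAlgebra k σ →ₐ[k] Module.End k W :=
  FreeAlgebra.lift k X

@[simp] lemma act_ι (X : σ → Module.End k W) (j : σ) : act X (FreeAlgebra.ι k j) = X j :=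
  FreeAlgebra.lift_ι_apply X j

/-- `S` intertwines the tuples of endomorphisms `X` and `X'`. -/
def Intertwines (X : σ → Module.End k W) (X' : σ → Module.End k W') (S : W →ₗ[k] W') : Prop :=
  ∀ j w, S (X j w) = X' j (S w)

/-- `U` is a common invariant subspace of the tuple of endomorphisms `X`. -/
def IsInvariant (X : σ → Module.End k W) (U : Submodule k W) : Prop :=
  ∀ j, ∀ w ∈ U, X j w ∈ U

lemma Intertwines.comp {W'' : Type*} [AddCommGroup W''] [Module k W''] {X : σ → Module.End k W}
    {X' : σ → Module.End k W'} {X'' : σ → Module.End k W''} {T : W' →ₗ[k] W''} {S : W →ₗ[k] W'}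
    (hT : Intertwines X' X'' T) (hS : Intertwines X X' S) : Intertwines X X'' (T ∘ₗ S) :=
  fun j w => (congrArg T (hS j w)).trans (hT j (S w))

lemma Intertwines.symm {X : σ → Module.End k W} {X' : σ → Module.End k W'} {e : W ≃ₗ[k] W'}
    (he : Intertwines X X' e.toLinearMap) : Intertwines X' X e.symm.toLinearMap :=
  fun j w => e.injective ((e.apply_symm_apply _).trans
    ((congrArg (X' j) (e.apply_symm_apply w).symm).trans (he j (e.symm w)).symm))

lemma Intertwines.map_act {X : σ → Module.End k W} {X' : σ → Module.End k W'} {S : W →ₗ[k] W'}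
    (hS : Intertwines X X' S) (p : FreeAlgebra k σ) (w : W) :
    S (act X p w) = act X' p (S w) := by
  induction p generalizing w with
  | grade0 c => simp only [AlgHom.commutes, Module.algebraMap_end_apply, map_smul]
  | grade1 j => simp only [act_ι, hS j]
  | mul p q hp hq => simp only [map_mul, Module.End.mul_apply, hp, hq]
  | add p q hp hq => simp only [map_add, LinearMap.add_apply, hp, hq]

lemma IsInvariant.act_mem {X : σ → Module.End k W} {U : Submodule k W} (hU : IsInvariant X U)
    (p : FreeAlgebra k σ) {w : W} (hw : w ∈ U) : act X p w ∈ U := by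
  induction p generalizing w with
  | grade0 c =>
    simpa only [AlgHom.commutes, Module.algebraMap_end_apply] using U.smul_mem c hw
  | grade1 j => simpa only [act_ι] using hU j w hw
  | mul p q hp hq => simpa only [map_mul, Module.End.mul_apply] using hp (hq hw)
  | add p q hp hq => simpa only [map_add, LinearMap.add_apply] using U.add_mem (hp hw) (hq hw)

end Action

section Evaluation

variable {k : Type*} [Field k] {g s : ℕ}

/-- The endomorphisms of `k^ι` given by a tuple of matrices, in particular by a point. -/
def pointOp {σ ι : Type*} [Fintype ι] (Y : σ → Matrix ι ι k) (j : σ) : Module.End k (ι → k) :=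
  (Y j).mulVecLin

@[simp] lemma pointOp_apply {σ ι : Type*} [Fintype ι] (Y : σ → Matrix ι ι k) (j : σ) (v : ι → k) :
    pointOp Y j v = (Y j).mulVec v := rfl

/-- Evaluation of noncommutative polynomials at a point, an algebra homomorphism; its underlying
function is `evalPoly`. -/
noncomputable def evalHom (Y : Point k g s) :
    FreeAlgebra k (Fin g) →ₐ[k] Matrix (Fin s) (Fin s) k :=
  FreeAlgebra.lift k Y

@[simp] lemma evalHom_ι (Y : Point k g s) (j : Fin g) : evalHom Y (FreeAlgebra.ι k j) = Y j :=
  FreeAlgebra.lift_ι_apply Y j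

lemma evalHom_mulVec (Y : Point k g s) (p : FreeAlgebra k (Fin g)) (v : Fin s → k) :
    (evalHom Y p).mulVec v = act (pointOp Y) p v := by
  have h : act (pointOp Y) = (Matrix.toLinAlgEquiv' (R := k)).toAlgHom.comp (evalHom Y) :=
    FreeAlgebra.hom_ext (funext fun j => LinearMap.ext fun v => by simp)
  simp [h]

/-- Evaluation of noncommutative polynomials at the point `Y + ε z` over the dual numbers. -/
noncomputable def dualEvalHom (Y z : Point k g s) :
    FreeAlgebra k (Fin g) →ₐ[k] DualNumber (Matrix (Fin s) (Fin s) k) :=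
  FreeAlgebra.lift k fun j => TrivSqZeroExt.inl (Y j) + TrivSqZeroExt.inr (z j)

lemma fst_dualEvalHom (Y z : Point k g s) (p : FreeAlgebra k (Fin g)) :
    (dualEvalHom Y z p).fst = evalHom Y p :=
  DFunLike.congr_fun (f := (TrivSqZeroExt.fstHom k _ _).comp (dualEvalHom Y z))
    (FreeAlgebra.hom_ext (funext fun j => by simp [dualEvalHom])) p

/-- The derivative of a noncommutative polynomial at `Y` in the direction `z`: the coefficient of
`ε` in its value at `Y + ε z`. -/
noncomputable def derivAt (Y z : Point k g s) (p : FreeAlgebra k (Fin g)) :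
    Matrix (Fin s) (Fin s) k :=
  (dualEvalHom Y z p).snd

@[simp] lemma derivAt_ι (Y z : Point k g s) (j : Fin g) :
    derivAt Y z (FreeAlgebra.ι k j) = z j := by
  simp [derivAt, dualEvalHom]

@[simp] lemma derivAt_algebraMap (Y z : Point k g s) (c : k) :
    derivAt Y z (algebraMap k _ c) = 0 := by
  simp [derivAt, TrivSqZeroExt.algebraMap_eq_inl']

@[simp] lemma derivAt_add (Y z : Point k g s) (p q : FreeAlgebra k (Fin g)) :
    derivAt Y z (p + q) = derivAt Y z p + derivAt Y z q := by
  simp [derivAt]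

@[simp] lemma derivAt_mul (Y z : Point k g s) (p q : FreeAlgebra k (Fin g)) :
    derivAt Y z (p * q) = evalHom Y p * derivAt Y z q + derivAt Y z p * evalHom Y q := by
  simp [derivAt, fst_dualEvalHom]

end Evaluation

section Sequences

variable {k : Type*} [Field k] {g s : ℕ}

lemma gapLeft_zero {m : ℕ} (f : MultiMap k g s m) (S : Matrix (Fin s) (Fin s) k)
    (Z : Fin m → Point k g s) : gapLeft f 0 S Z = S * f Z := rfl

lemma gapLeft_succ {m : ℕ} (f : MultiMap k g s m) (j : Fin m) (S : Matrix (Fin s) (Fin s) k)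
    (Z : Fin m → Point k g s) :
    gapLeft f j.succ S Z = f (Function.update Z j (rmul (Z j) S)) := rfl

lemma gapRight_last {m : ℕ} (f : MultiMap k g s m) (S : Matrix (Fin s) (Fin s) k)
    (Z : Fin m → Point k g s) : gapRight f (Fin.last m) S Z = f Z * S := by
  simp only [gapRight, Fin.lastCases_last]

lemma gapRight_castSucc {m : ℕ} (f : MultiMap k g s m) (j : Fin m) (S : Matrix (Fin s) (Fin s) k)
    (Z : Fin m → Point k g s) :
    gapRight f j.castSucc S Z = f (Function.update Z j (lmul S (Z j))) := by
  simp only [gapRight, Fin.lastCases_castSucc]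

/-- The difference of the two ways of inserting `S` into the gap `t` of `f (Z^1, …, Z^m)`, as a
linear function of `f`. -/
def gapComm {m : ℕ} (t : Fin (m + 1)) (S : Matrix (Fin s) (Fin s) k) (Z : Fin m → Point k g s) :
    MultiMap k g s m →ₗ[k] Matrix (Fin s) (Fin s) k where
  toFun f := gapLeft f t S Z - gapRight f t S Z
  map_add' f f' := by
    have hl : gapLeft (f + f') t S Z = gapLeft f t S Z + gapLeft f' t S Z := by
      cases t using Fin.cases <;> simp [gapLeft_zero, gapLeft_succ, mul_add]
    have hr : gapRight (f + f') t S Z = gapRight f t S Z + gapRight f' t S Z := by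
      cases t using Fin.lastCases <;> simp [gapRight_last, gapRight_castSucc, add_mul]
    rw [hl, hr, add_sub_add_comm]
  map_smul' c f := by
    have hl : gapLeft (c • f) t S Z = c • gapLeft f t S Z := by
      cases t using Fin.cases <;> simp [gapLeft_zero, gapLeft_succ]
    have hr : gapRight (c • f) t S Z = c • gapRight f t S Z := by
      cases t using Fin.lastCases <;> simp [gapRight_last, gapRight_castSucc]
    rw [hl, hr, RingHom.id_apply, smul_sub]

variable (k g s) in
/-- Sequences of `ℓ`-linear maps, `ℓ = 0, 1, 2, …`. -/
abbrev Seq : Type _ := ∀ ℓ : ℕ, MultiMap k g s ℓ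

/-- The multilinear map `(z, Z^1, …, Z^m) ↦ z_j f (Z^1, …, Z^m)`. -/
noncomputable def consMul (j : Fin g) {m : ℕ} (f : MultiMap k g s m) : MultiMap k g s (m + 1) :=
  LinearMap.uncurryLeft (M := fun _ : Fin (m + 1) => Point k g s)
    { toFun := fun z => (LinearMap.mulLeft k (z j)).compMultilinearMap f
      map_add' := fun z z' => MultilinearMap.ext fun Z => by simp [add_mul]
      map_smul' := fun c z => MultilinearMap.ext fun Z => by simp }

@[simp] lemma consMul_apply (j : Fin g) {m : ℕ} (f : MultiMap k g s m)
    (Z : Fin (m + 1) → Point k g s) : consMul j f Z = Z 0 j * f (Fin.tail Z) := rfl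

/-- The effect of multiplication by `x_j` on the sequence of differentials at `Y`; the formula is
the Leibniz rule, as `x_j` has only the differentials `Y_j` and `z ↦ z_j`. -/
noncomputable def varMul (Y : Point k g s) (j : Fin g) : Module.End k (Seq k g s) where
  toFun F := fun ℓ => match ℓ with
    | 0 => (LinearMap.mulLeft k (Y j)).compMultilinearMap (F 0)
    | m + 1 => (LinearMap.mulLeft k (Y j)).compMultilinearMap (F (m + 1)) + consMul j (F m)
  map_add' F G := by
    funext ℓ
    cases ℓ
    · exact MultilinearMap.ext fun Z => by simp
    · exact MultilinearMap.ext fun Z => by simp [mul_add]; abel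
  map_smul' c F := by
    funext ℓ
    cases ℓ
    · exact MultilinearMap.ext fun Z => by simp
    · exact MultilinearMap.ext fun Z => by simp

@[simp] lemma varMul_zero (Y : Point k g s) (j : Fin g) (F : Seq k g s) (Z : Fin 0 → Point k g s) :
    varMul Y j F 0 Z = Y j * F 0 Z := rfl

@[simp] lemma varMul_succ (Y : Point k g s) (j : Fin g) (F : Seq k g s) (m : ℕ)
    (Z : Fin (m + 1) → Point k g s) :
    varMul Y j F (m + 1) Z = Y j * F (m + 1) Z + Z 0 j * F m (Fin.tail Z) := rfl

variable (k g s) in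
/-- The differentials of the constant polynomial `1`. -/
noncomputable def oneSeq : Seq k g s := fun ℓ => match ℓ with
  | 0 => MultilinearMap.constOfIsEmpty k _ 1
  | _ + 1 => 0

@[simp] lemma oneSeq_zero (Z : Fin 0 → Point k g s) : oneSeq k g s 0 Z = 1 := rfl

@[simp] lemma oneSeq_succ (m : ℕ) : oneSeq k g s (m + 1) = 0 := rfl

/-- The sequence of all differentials at `Y` of a noncommutative polynomial. -/
noncomputable def polyDiff (Y : Point k g s) : FreeAlgebra k (Fin g) →ₗ[k] Seq k g s :=
  (LinearMap.applyₗ (oneSeq k g s)).comp (act (varMul Y)).toLinearMap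

lemma polyDiff_apply (Y : Point k g s) (p : FreeAlgebra k (Fin g)) :
    polyDiff Y p = act (varMul Y) p (oneSeq k g s) := rfl

lemma polyDiff_mul (Y : Point k g s) (p q : FreeAlgebra k (Fin g)) :
    polyDiff Y (p * q) = act (varMul Y) p (polyDiff Y q) := by
  simp only [polyDiff_apply, map_mul, Module.End.mul_apply]

end Sequences

section LeadingCoefficients

variable {k : Type*} [Field k] {g s : ℕ}

variable (k g s) in
/-- The sequences of multilinear maps whose terms of order less than `n` are zero. -/
def vanishBelow (n : ℕ) : Submodule k (Seq k g s) where
  carrier := {F | ∀ ℓ < n, F ℓ = 0}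
  zero_mem' := fun _ _ => rfl
  add_mem' := fun hF hG ℓ hℓ => by simp [hF ℓ hℓ, hG ℓ hℓ]
  smul_mem' := fun c F hF ℓ hℓ => by simp [hF ℓ hℓ]

lemma mem_vanishBelow_zero (F : Seq k g s) : F ∈ vanishBelow k g s 0 :=
  fun _ hℓ => (Nat.not_lt_zero _ hℓ).elim

lemma isInvariant_vanishBelow (Y : Point k g s) (n : ℕ) :
    IsInvariant (varMul Y) (vanishBelow k g s n) := by
  intro j F hF ℓ hℓ
  refine MultilinearMap.ext fun Z => ?_
  cases ℓ with
  | zero => simp [hF 0 hℓ]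
  | succ ℓ => simp [hF _ hℓ, hF ℓ (by omega)]

lemma act_varMul_leading (Y : Point k g s) (p : FreeAlgebra k (Fin g)) {n : ℕ} {F : Seq k g s}
    (hF : F ∈ vanishBelow k g s n) (Z : Fin n → Point k g s) :
    act (varMul Y) p F n Z = evalHom Y p * F n Z := by
  induction p generalizing F with
  | grade0 c => simp [Algebra.algebraMap_eq_smul_one]
  | grade1 j =>
    cases n with
    | zero => simp
    | succ n => simp [hF n n.lt_succ_self]
  | mul p q hp hq =>
    simp only [map_mul, Module.End.mul_apply, hq hF, mul_assoc,
      hp ((isInvariant_vanishBelow Y n).act_mem q hF)]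
  | add p q hp hq => simp [hp hF, hq hF, add_mul]

lemma act_varMul_next (Y : Point k g s) (p : FreeAlgebra k (Fin g)) {n : ℕ} {F : Seq k g s}
    (hF : F ∈ vanishBelow k g s n) (Z : Fin (n + 1) → Point k g s) :
    act (varMul Y) p F (n + 1) Z
      = evalHom Y p * F (n + 1) Z + derivAt Y (Z 0) p * F n (Fin.tail Z) := by
  induction p generalizing F with
  | grade0 c =>
    rw [derivAt_algebraMap, zero_mul, add_zero, AlgHom.commutes, AlgHom.commutes,
      Module.algebraMap_end_apply, ← Algebra.smul_def]
    rfl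
  | grade1 j => simp
  | mul p q hp hq =>
    simp only [map_mul, Module.End.mul_apply, hp ((isInvariant_vanishBelow Y n).act_mem q hF),
      hq hF, act_varMul_leading Y q hF, derivAt_mul]
    noncomm_ring
  | add p q hp hq =>
    simp only [map_add, LinearMap.add_apply, Pi.add_apply, add_apply, hp hF, hq hF,
      derivAt_add]
    noncomm_ring

lemma polyDiff_zero_apply (Y : Point k g s) (p : FreeAlgebra k (Fin g)) (Z : Fin 0 → Point k g s) :
    polyDiff Y p 0 Z = evalHom Y p := by
  rw [polyDiff_apply, act_varMul_leading Y p (mem_vanishBelow_zero _), oneSeq_zero, mul_one]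

end LeadingCoefficients

section Compatibility

variable {k : Type*} [Field k] {g s : ℕ}

/-- The linear compatibility conditions of all orders at `Y`, as a space of sequences. -/
def lacSubmodule (Y : Point k g s) : Submodule k (Seq k g s) where
  carrier := {F | ∀ (m : ℕ) (t : Fin (m + 1)) (S : Matrix (Fin s) (Fin s) k)
    (Z : Fin m → Point k g s),
    F (m + 1) (Fin.insertNth (α := fun _ => Point k g s) t (bracket S Y) Z)
      = gapComm t S Z (F m)}
  zero_mem' := fun m t S Z => by simp
  add_mem' := fun hF hG m t S Z => by
    simp only [Pi.add_apply, add_apply, map_add, hF m t S Z, hG m t S Z]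
  smul_mem' := fun c F hF m t S Z => by
    simp only [Pi.smul_apply, smul_apply, map_smul, hF m t S Z]

lemma gapComm_zero_varMul (Y : Point k g s) (j : Fin g) (F : Seq k g s) (m : ℕ)
    (S : Matrix (Fin s) (Fin s) k) (Z : Fin m → Point k g s) :
    gapComm 0 S Z (varMul Y j F m)
      = Y j * gapComm 0 S Z (F m) + bracket S Y j * F m Z := by
  simp only [gapComm, LinearMap.coe_mk, AddHom.coe_mk, gapLeft_zero, bracket]
  cases m with
  | zero =>
    have h0 : (0 : Fin (0 + 1)) = Fin.last 0 := rfl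
    rw [h0, gapRight_last, gapRight_last, varMul_zero]
    noncomm_ring
  | succ m =>
    have h0 : (0 : Fin (m + 1 + 1)) = (0 : Fin (m + 1)).castSucc := rfl
    rw [h0, gapRight_castSucc, gapRight_castSucc, varMul_succ, varMul_succ, Fin.tail_update_zero]
    simp only [Function.update_self, lmul]
    noncomm_ring

lemma gapComm_succ_varMul (Y : Point k g s) (j : Fin g) (F : Seq k g s) (m : ℕ) (t : Fin (m + 1))
    (S : Matrix (Fin s) (Fin s) k) (Z : Fin (m + 1) → Point k g s) :
    gapComm t.succ S Z (varMul Y j F (m + 1))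
      = Y j * gapComm t.succ S Z (F (m + 1)) + Z 0 j * gapComm t S (Fin.tail Z) (F m) := by
  have hl : gapLeft (varMul Y j F (m + 1)) t.succ S Z
      = Y j * gapLeft (F (m + 1)) t.succ S Z + Z 0 j * gapLeft (F m) t S (Fin.tail Z) := by
    cases t using Fin.cases with
    | zero =>
      rw [gapLeft_succ, gapLeft_succ, gapLeft_zero, varMul_succ, Fin.tail_update_zero]
      simp [rmul, mul_assoc]
    | succ i =>
      rw [gapLeft_succ, gapLeft_succ, gapLeft_succ, varMul_succ, Fin.tail_update_succ,
        Function.update_of_ne (Fin.succ_ne_zero i).symm]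
      simp [Fin.tail]
  have hr : gapRight (varMul Y j F (m + 1)) t.succ S Z
      = Y j * gapRight (F (m + 1)) t.succ S Z + Z 0 j * gapRight (F m) t S (Fin.tail Z) := by
    cases t using Fin.lastCases with
    | last =>
      rw [Fin.succ_last, gapRight_last, gapRight_last, gapRight_last, varMul_succ]
      simp [add_mul, mul_assoc]
    | cast i =>
      rw [Fin.succ_castSucc, gapRight_castSucc, gapRight_castSucc, gapRight_castSucc, varMul_succ,
        Fin.tail_update_succ, Function.update_of_ne (Fin.succ_ne_zero i).symm]
      simp [Fin.tail]
  simp only [gapComm, LinearMap.coe_mk, AddHom.coe_mk, hl, hr]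
  noncomm_ring

lemma isInvariant_lacSubmodule (Y : Point k g s) : IsInvariant (varMul Y) (lacSubmodule Y) := by
  intro j F hF m t S Z
  cases t using Fin.cases with
  | zero => rw [varMul_succ, gapComm_zero_varMul, hF m 0 S Z]; simp
  | succ t =>
    cases m with
    | zero => exact t.elim0
    | succ m =>
      have htail : Fin.tail (Fin.insertNth (α := fun _ => Point k g s) t.succ (bracket S Y) Z)
          = Fin.insertNth (α := fun _ => Point k g s) t (bracket S Y) (Fin.tail Z) := by
        refine Fin.eq_insertNth_iff.mpr ⟨by simp [Fin.tail], funext fun i => ?_⟩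
        simp only [Fin.removeNth, Fin.tail]
        rw [← Fin.succ_succAbove_succ, Fin.insertNth_apply_succAbove]
      have hhead : Fin.insertNth (α := fun _ => Point k g s) t.succ (bracket S Y) Z 0 = Z 0 := by
        rw [← Fin.succ_succAbove_zero t, Fin.insertNth_apply_succAbove]
      rw [varMul_succ, gapComm_succ_varMul, htail, hhead, hF, hF]

lemma oneSeq_mem_lacSubmodule (Y : Point k g s) : oneSeq k g s ∈ lacSubmodule Y := by
  intro m t S Z
  cases m with
  | zero =>
    obtain rfl : t = Fin.last 0 := Fin.fin_one_eq_zero t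
    simp only [gapComm, LinearMap.coe_mk, AddHom.coe_mk, gapRight_last]
    simp [gapLeft]
  | succ m => simp

lemma polyDiff_mem_lacSubmodule (Y : Point k g s) (p : FreeAlgebra k (Fin g)) :
    polyDiff Y p ∈ lacSubmodule Y :=
  (isInvariant_lacSubmodule Y).act_mem p (oneSeq_mem_lacSubmodule Y)

lemma bracket_eq_zero {S : Matrix (Fin s) (Fin s) k} {Y : Point k g s}
    (hS : ∀ j, S * Y j = Y j * S) : bracket S Y = 0 :=
  funext fun j => sub_eq_zero.mpr (hS j)

lemma gapComm_eq_zero_of_mem_lacSubmodule {Y : Point k g s} {F : Seq k g s}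
    (hF : F ∈ lacSubmodule Y) {S : Matrix (Fin s) (Fin s) k} (hS : ∀ j, S * Y j = Y j * S)
    {m : ℕ} (t : Fin (m + 1)) (Z : Fin m → Point k g s) : gapComm t S Z (F m) = 0 := by
  rw [← hF m t S Z, bracket_eq_zero hS, MultilinearMap.map_coord_zero _ t (by simp)]

end Compatibility

section BlockBidiagonal

variable {k : Type*} [Field k] {g s : ℕ}

/-- The block bidiagonal operators on `(k^s)^(ℓ+1)`, with `Y` in the diagonal blocks and `Z` in the
blocks directly above the diagonal. -/
def chainOp (Y : Point k g s) {ℓ : ℕ} (Z : Fin ℓ → Point k g s) (j : Fin g) :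
    Module.End k (Fin (ℓ + 1) → Fin s → k) :=
  LinearMap.pi fun a => (pointOp Y j).comp (LinearMap.proj a) +
    Fin.snoc (α := fun _ => (Fin (ℓ + 1) → Fin s → k) →ₗ[k] (Fin s → k))
      (fun i => (pointOp (Z i) j).comp (LinearMap.proj i.succ)) 0 a

lemma chainOp_last (Y : Point k g s) {ℓ : ℕ} (Z : Fin ℓ → Point k g s) (j : Fin g)
    (w : Fin (ℓ + 1) → Fin s → k) :
    chainOp Y Z j w (Fin.last ℓ) = (Y j).mulVec (w (Fin.last ℓ)) := by
  simp [chainOp]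

lemma chainOp_castSucc (Y : Point k g s) {ℓ : ℕ} (Z : Fin ℓ → Point k g s) (j : Fin g)
    (w : Fin (ℓ + 1) → Fin s → k) (i : Fin ℓ) :
    chainOp Y Z j w i.castSucc = (Y j).mulVec (w i.castSucc) + (Z i j).mulVec (w i.succ) := by
  simp [chainOp]

lemma chainOp_cons (Y : Point k g s) {ℓ : ℕ} (Z : Fin (ℓ + 1) → Point k g s) (j : Fin g)
    (v : Fin s → k) (w : Fin (ℓ + 1) → Fin s → k) :
    chainOp Y Z j (Fin.cons (α := fun _ => Fin s → k) v w)
      = Fin.cons (α := fun _ => Fin s → k) ((Y j).mulVec v + (Z 0 j).mulVec (w 0))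
          (chainOp Y (Fin.tail Z) j w) := by
  funext a
  cases a using Fin.cases with
  | zero => rw [← Fin.castSucc_zero, chainOp_castSucc]; simp
  | succ a =>
    cases a using Fin.lastCases with
    | last =>
      rw [Fin.succ_last, chainOp_last, ← Fin.succ_last, Fin.cons_succ, Fin.cons_succ, chainOp_last]
    | cast i =>
      rw [Fin.succ_castSucc, chainOp_castSucc, ← Fin.succ_castSucc, Fin.cons_succ, Fin.cons_succ,
        Fin.cons_succ, chainOp_castSucc]
      rfl

variable (k s) in
/-- Splitting a vector of size `(ℓ + 1) s` into `ℓ + 1` blocks. -/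
def blocks (ℓ : ℕ) : (Fin ((ℓ + 1) * s) → k) ≃ₗ[k] (Fin (ℓ + 1) → Fin s → k) :=
  (LinearEquiv.funCongrLeft k k finProdFinEquiv).trans
    (LinearEquiv.curry k k (Fin (ℓ + 1)) (Fin s))

@[simp] lemma blocks_apply {ℓ : ℕ} (v : Fin ((ℓ + 1) * s) → k) (a : Fin (ℓ + 1)) (b : Fin s) :
    blocks k s ℓ v a b = v (finProdFinEquiv (a, b)) := rfl

lemma blocks_symm_single {ℓ : ℕ} (a : Fin (ℓ + 1)) (b : Fin s) :
    (blocks k s ℓ).symm (Pi.single a (Pi.single b 1)) = Pi.single (finProdFinEquiv (a, b)) 1 := by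
  rw [LinearEquiv.symm_apply_eq]
  funext c d
  rw [blocks_apply]
  by_cases hc : c = a
  · subst hc; simp [Pi.single_apply]
  · simp [hc]

lemma intertwines_blocks_bidiag (Y : Point k g s) {ℓ : ℕ} (Z : Fin ℓ → Point k g s) :
    Intertwines (pointOp (bidiag Y Z)) (chainOp Y Z) (blocks k s ℓ).toLinearMap := by
  intro j v
  funext a b
  have hsum : blocks k s ℓ (pointOp (bidiag Y Z) j v) a b
      = ∑ c, ∑ d, (if a = c then Y j b d
        else if hb : a.val + 1 = c.val then Z ⟨a.val, by have := c.isLt; omega⟩ j b d else 0)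
          * v (finProdFinEquiv (c, d)) := by
    rw [blocks_apply, pointOp_apply, Matrix.mulVec, dotProduct, ← finProdFinEquiv.sum_comp,
      Fintype.sum_prod_type]
    simp [bidiag]
  rw [LinearEquiv.coe_coe, hsum]
  cases a using Fin.lastCases with
  | last =>
    rw [chainOp_last, Finset.sum_eq_single (Fin.last ℓ)]
    · simp [Matrix.mulVec, dotProduct]
    · intro c _ hc
      refine Finset.sum_eq_zero fun d _ => ?_
      have := c.isLt
      rw [if_neg hc.symm, dif_neg (by simp only [Fin.val_last]; omega), zero_mul]
    · simp
  | cast i =>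
    rw [chainOp_castSucc, ← Finset.sum_subset (Finset.subset_univ {i.castSucc, i.succ}),
      Finset.sum_pair Fin.castSucc_lt_succ.ne]
    · simp [Matrix.mulVec, dotProduct, (Fin.castSucc_lt_succ (i := i)).ne]
    · intro c _ hc
      simp only [Finset.mem_insert, Finset.mem_singleton, not_or] at hc
      refine Finset.sum_eq_zero fun d _ => ?_
      rw [if_neg (Ne.symm hc.1), dif_neg fun h => hc.2 (Fin.ext (by simpa using h.symm)), zero_mul]

/-- The linear map `F ↦ F_ℓ(Z) η`. -/
def valueAt (η : Fin s → k) {ℓ : ℕ} (Z : Fin ℓ → Point k g s) : Seq k g s →ₗ[k] (Fin s → k) where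
  toFun F := (F ℓ Z).mulVec η
  map_add' F G := by simp [Matrix.add_mulVec]
  map_smul' c F := by simp [Matrix.smul_mulVec]

/-- The column vector `(F_ℓ(Z^1, …, Z^ℓ) η, F_{ℓ-1}(Z^2, …, Z^ℓ) η, …, F_0 η)`. -/
def chainVec (η : Fin s → k) : ∀ {ℓ : ℕ}, (Fin ℓ → Point k g s) →
    Seq k g s →ₗ[k] (Fin (ℓ + 1) → Fin s → k)
  | 0, Z => LinearMap.pi fun _ => valueAt η Z
  | ℓ + 1, Z => (Fin.consLinearEquiv k fun _ : Fin (ℓ + 2) => Fin s → k).toLinearMap.comp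
      ((valueAt η Z).prod (chainVec η (Fin.tail Z)))

lemma chainVec_succ (η : Fin s → k) {ℓ : ℕ} (Z : Fin (ℓ + 1) → Point k g s) (F : Seq k g s) :
    chainVec η Z F = Fin.cons (α := fun _ => Fin s → k) ((F (ℓ + 1) Z).mulVec η)
      (chainVec η (Fin.tail Z) F) := rfl

lemma chainVec_apply_zero (η : Fin s → k) {ℓ : ℕ} (Z : Fin ℓ → Point k g s) (F : Seq k g s) :
    chainVec η Z F 0 = (F ℓ Z).mulVec η := by
  cases ℓ <;> rfl

lemma intertwines_chainVec (η : Fin s → k) (Y : Point k g s) {ℓ : ℕ} (Z : Fin ℓ → Point k g s) :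
    Intertwines (varMul Y) (chainOp Y Z) (chainVec η Z) := by
  intro j F
  induction ℓ with
  | zero =>
    funext a
    obtain rfl : a = Fin.last 0 := Fin.fin_one_eq_zero a
    rw [chainOp_last]
    exact (Matrix.mulVec_mulVec η (Y j) (F 0 Z)).symm
  | succ ℓ ih =>
    rw [chainVec_succ, chainVec_succ, chainOp_cons, ih, chainVec_apply_zero]
    simp [Matrix.add_mulVec]

lemma chainVec_oneSeq (η : Fin s → k) {ℓ : ℕ} (Z : Fin ℓ → Point k g s) :
    chainVec η Z (oneSeq k g s) = Pi.single (Fin.last ℓ) η := by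
  induction ℓ with
  | zero =>
    funext a
    obtain rfl : a = Fin.last 0 := Fin.fin_one_eq_zero a
    simp [chainVec, valueAt]
  | succ ℓ ih =>
    funext a
    cases a using Fin.cases with
    | zero => simp [chainVec_succ]
    | succ a => simp only [chainVec_succ, Fin.cons_succ, ih, ← Fin.succ_last, Pi.single_apply,
        Fin.succ_inj]

lemma topRight_apply {ℓ : ℕ} (M : Matrix (Fin ((ℓ + 1) * s)) (Fin ((ℓ + 1) * s)) k)
    (a b : Fin s) :
    topRight M a b = blocks k s ℓ (M.mulVec ((blocks k s ℓ).symm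
      (Pi.single (Fin.last ℓ) (Pi.single b 1)))) 0 a := by
  simp [blocks_symm_single, topRight]

lemma isNCDifferential_polyDiff (Y : Point k g s) (p : FreeAlgebra k (Fin g)) (ℓ : ℕ) :
    IsNCDifferential (fun _ => Set.univ) (evalPoly p) Y (polyDiff Y p ℓ) := by
  intro Z _
  ext a b
  calc topRight (evalPoly p ((ℓ + 1) * s) (bidiag Y Z)) a b
      = blocks k s ℓ ((evalHom (bidiag Y Z) p).mulVec ((blocks k s ℓ).symm
          (Pi.single (Fin.last ℓ) (Pi.single b 1)))) 0 a := topRight_apply ..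
    _ = act (chainOp Y Z) p (chainVec (Pi.single b 1) Z (oneSeq k g s)) 0 a := by
      rw [evalHom_mulVec, chainVec_oneSeq, ← LinearEquiv.coe_coe,
        (intertwines_blocks_bidiag Y Z).map_act, LinearEquiv.coe_coe,
        LinearEquiv.apply_symm_apply]
    _ = chainVec (Pi.single b 1) Z (polyDiff Y p) 0 a := by
      rw [← (intertwines_chainVec _ Y Z).map_act, polyDiff_apply]
    _ = polyDiff Y p ℓ Z a b := by
      rw [chainVec_apply_zero, Matrix.mulVec_single_one, Matrix.col_apply]

end BlockBidiagonal

section OperatorModules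

variable {k σ W W' : Type*} [Field k] [AddCommGroup W] [Module k W] [AddCommGroup W'] [Module k W']

/-- A copy of the space `W`, as a module over the free algebra on which each variable `x_j` acts as
the endomorphism `X j`. -/
def OpModule (_X : σ → Module.End k W) : Type _ := W

namespace OpModule

instance (X : σ → Module.End k W) : AddCommGroup (OpModule X) := inferInstanceAs (AddCommGroup W)

instance (X : σ → Module.End k W) : Module k (OpModule X) := inferInstanceAs (Module k W)

noncomputable instance (X : σ → Module.End k W) : Module (FreeAlgebra k σ) (OpModule X) :=
  Module.compHom W (act X).toRingHom

/-- The identification of the space `W` with the module given by endomorphisms of `W`. -/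
def of (X : σ → Module.End k W) : W ≃ₗ[k] OpModule X := LinearEquiv.refl k W

variable {X : σ → Module.End k W} {X' : σ → Module.End k W'}

lemma smul_of (p : FreeAlgebra k σ) (w : W) : p • of X w = of X (act X p w) := rfl

instance : IsScalarTower k (FreeAlgebra k σ) (OpModule X) where
  smul_assoc c p w := by
    obtain ⟨w, rfl⟩ := (of X).surjective w
    simp [smul_of]

/-- The module homomorphism given by an intertwiner. -/
noncomputable def homOfIntertwines {S : W →ₗ[k] W'} (hS : Intertwines X X' S) :
    OpModule X →ₗ[FreeAlgebra k σ] OpModule X' where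
  toFun w := of X' (S ((of X).symm w))
  map_add' := by simp
  map_smul' p w := congrArg (of X') (hS.map_act p ((of X).symm w))

/-- The module isomorphism given by an invertible intertwiner. -/
noncomputable def equivOfIntertwines {E : W ≃ₗ[k] W'} (hE : Intertwines X X' E.toLinearMap) :
    OpModule X ≃ₗ[FreeAlgebra k σ] OpModule X' :=
  LinearEquiv.ofBijective (homOfIntertwines hE) E.bijective

/-- A module homomorphism, as a linear map between the underlying spaces. -/
noncomputable def toLin (φ : OpModule X →ₗ[FreeAlgebra k σ] OpModule X') : W →ₗ[k] W' :=
  (of X').symm.toLinearMap ∘ₗ φ.restrictScalars k ∘ₗ (of X).toLinearMap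

lemma of_toLin (φ : OpModule X →ₗ[FreeAlgebra k σ] OpModule X') (w : W) :
    of X' (toLin φ w) = φ (of X w) := rfl

lemma intertwines_toLin (φ : OpModule X →ₗ[FreeAlgebra k σ] OpModule X') :
    Intertwines X X' (toLin φ) := by
  intro j w
  apply (of X').injective
  have hφ := φ.map_smul (FreeAlgebra.ι k j) (of X w)
  rwa [smul_of, act_ι, ← of_toLin, ← of_toLin, smul_of, act_ι] at hφ

/-- The submodule given by an invariant subspace. -/
noncomputable def submoduleOf {U : Submodule k W} (hU : IsInvariant X U) :
    Submodule (FreeAlgebra k σ) (OpModule X) where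
  carrier := {w | (of X).symm w ∈ U}
  add_mem' := U.add_mem
  zero_mem' := U.zero_mem
  smul_mem' p _ hw := hU.act_mem p hw

lemma of_mem_submoduleOf {U : Submodule k W} (hU : IsInvariant X U) (w : W) :
    of X w ∈ submoduleOf hU ↔ w ∈ U := Iff.rfl

/-- The underlying subspace of a submodule. -/
noncomputable def subspaceOf (N : Submodule (FreeAlgebra k σ) (OpModule X)) : Submodule k W :=
  (N.restrictScalars k).comap (of X).toLinearMap

lemma mem_subspaceOf {N : Submodule (FreeAlgebra k σ) (OpModule X)} {w : W} :
    w ∈ subspaceOf N ↔ of X w ∈ N := Iff.rfl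

lemma isInvariant_subspaceOf (N : Submodule (FreeAlgebra k σ) (OpModule X)) :
    IsInvariant X (subspaceOf N) := by
  intro j w hw
  have hmem := N.smul_mem (FreeAlgebra.ι k j) (mem_subspaceOf.mp hw)
  rwa [smul_of, act_ι] at hmem

end OpModule

/-- The tuple of endomorphisms of a product that act as `X a` on the component `a`. -/
def piOp {α : Type*} {V : α → Type*} [∀ a, AddCommGroup (V a)] [∀ a, Module k (V a)]
    (X : ∀ a, σ → Module.End k (V a)) (j : σ) : Module.End k (∀ a, V a) :=
  LinearMap.pi fun a => (X a j).comp (LinearMap.proj a)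

/-- The module of a product tuple is the product of the modules. -/
noncomputable def OpModule.piEquiv {α : Type*} {V : α → Type*} [∀ a, AddCommGroup (V a)]
    [∀ a, Module k (V a)]
    (X : ∀ a, σ → Module.End k (V a)) :
    OpModule (piOp X) ≃ₗ[FreeAlgebra k σ] ∀ a, OpModule (X a) where
  toFun v a := of (X a) ((of (piOp X)).symm v a)
  invFun v := of (piOp X) fun a => (of (X a)).symm (v a)
  map_add' _ _ := rfl
  map_smul' p v := funext fun a =>
    have hproj : Intertwines (piOp X) (X a) (LinearMap.proj a) := fun _ _ => rfl
    congrArg (of (X a)) (hproj.map_act p ((of (piOp X)).symm v))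
  left_inv _ := rfl
  right_inv _ := rfl

end OperatorModules

section PointModules

open OpModule

variable {k : Type*} [Field k] {g s s' : ℕ}

/-- The module over the free algebra given by a point. -/
abbrev PtMod (Y : Point k g s) : Type _ := OpModule (pointOp Y)

lemma IsIrreduciblePoint.isSimpleModule {Y : Point k g s} (hY : IsIrreduciblePoint Y) :
    IsSimpleModule (FreeAlgebra k (Fin g)) (PtMod Y) := by
  obtain ⟨hs, hinv⟩ := hY
  have : Nonempty (Fin s) := ⟨⟨0, hs⟩⟩
  have : Nontrivial (PtMod Y) := inferInstanceAs (Nontrivial (Fin s → k))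
  rw [isSimpleModule_iff]
  refine { exists_pair_ne := ⟨⊥, ⊤, bot_ne_top⟩, eq_bot_or_eq_top := fun N => ?_ }
  refine (hinv _ (isInvariant_subspaceOf N)).imp (fun hN => ?_) fun hN => ?_
  · exact eq_bot_iff.mpr fun w hw => hN.le hw
  · exact eq_top_iff.mpr fun w _ => hN.ge (Submodule.mem_top (x := w))

lemma Similar.exists_intertwines {ι ι' : Type} [Fintype ι] [Fintype ι'] [DecidableEq ι']
    {Y : Fin g → Matrix ι ι k} {Y' : Fin g → Matrix ι' ι' k} (h : Similar Y Y') :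
    ∃ E : (ι → k) ≃ₗ[k] (ι' → k), Intertwines (pointOp Y) (pointOp Y') E.toLinearMap := by
  obtain ⟨e, P, hP⟩ := h
  refine ⟨(LinearEquiv.funCongrLeft k k e.symm).trans
    (Matrix.toLin'OfInv P.inv_mul P.mul_inv), fun j v => ?_⟩
  have hreindex : (LinearEquiv.funCongrLeft k k e.symm) ((Y j).mulVec v)
      = (Matrix.reindex e e (Y j)).mulVec ((LinearEquiv.funCongrLeft k k e.symm) v) := by
    funext i
    simp [Matrix.mulVec, dotProduct, LinearEquiv.funCongrLeft_apply, LinearMap.funLeft_apply,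
      ← e.sum_comp]
  have hinv : ∀ u, Matrix.toLin'OfInv P.inv_mul P.mul_inv u = P.val.mulVec u := fun _ => rfl
  rw [LinearEquiv.coe_coe, LinearEquiv.trans_apply, LinearEquiv.trans_apply, pointOp_apply,
    pointOp_apply, hreindex, hinv, hinv, hP, Matrix.mulVec_mulVec, Matrix.mulVec_mulVec, mul_assoc,
    Units.inv_mul, mul_one]

lemma similar_of_intertwines {Y : Point k g s} {Y' : Point k g s'}
    {E : (Fin s → k) ≃ₗ[k] (Fin s' → k)}
    (hE : Intertwines (pointOp Y) (pointOp Y') E.toLinearMap) : Similar Y Y' := by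
  obtain rfl : s = s' := by simpa using E.finrank_eq
  let P := LinearMap.toMatrix' E.toLinearMap
  let Q := LinearMap.toMatrix' E.symm.toLinearMap
  have hPQ : P * Q = 1 := by rw [← LinearMap.toMatrix'_comp]; simp
  have hQP : Q * P = 1 := by rw [← LinearMap.toMatrix'_comp]; simp
  have hP : ∀ j, P * Y j = Y' j * P := fun j =>
    Matrix.toLin'.injective (LinearMap.ext fun v => by simpa [P, Matrix.toLin'_mul] using hE j v)
  refine ⟨Equiv.refl _, ⟨P, Q, hPQ, hQP⟩, fun j => ?_⟩
  simp only [Matrix.reindex_refl_refl, Units.inv_mk]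
  rw [hP, mul_assoc, hPQ, mul_one]

lemma intertwines_blockDiagonal' {σ α : Type*} [Fintype α] [DecidableEq α] {n : α → ℕ}
    (B : ∀ a, σ → Matrix (Fin (n a)) (Fin (n a)) k) :
    Intertwines (pointOp fun j => Matrix.blockDiagonal' fun a => B a j)
      (piOp fun a => pointOp (B a))
      (LinearEquiv.piCurry k fun (a : α) (_ : Fin (n a)) => k).toLinearMap := by
  intro j v
  funext a b
  change (Matrix.blockDiagonal' fun a => B a j).mulVec v ⟨a, b⟩
    = (B a j).mulVec (fun b => v ⟨a, b⟩) b
  simp only [Matrix.mulVec, dotProduct, Fintype.sum_sigma]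
  rw [Finset.sum_eq_single a]
  · simp [Matrix.blockDiagonal'_apply]
  · intro a' _ ha'
    exact Finset.sum_eq_zero fun b' _ => by
      rw [Matrix.blockDiagonal'_apply_ne _ _ _ ha'.symm, zero_mul]
  · simp

lemma IsIrredDecomp.nonempty_equiv {Y : Point k g s} {r : ℕ} {n : Fin r → ℕ}
    {B : ∀ a, Point k g (n a)} (h : IsIrredDecomp Y B) :
    Nonempty (PtMod Y ≃ₗ[FreeAlgebra k (Fin g)] ∀ a, PtMod (B a)) := by
  obtain ⟨E, hE⟩ := h.2.exists_intertwines
  exact ⟨(equivOfIntertwines hE).symm ≪≫ₗ equivOfIntertwines (intertwines_blockDiagonal' B) ≪≫ₗ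
    piEquiv fun a => pointOp (B a)⟩

lemma IsSemisimplePoint.isSemisimpleModule {Y : Point k g s} (hY : IsSemisimplePoint Y) :
    IsSemisimpleModule (FreeAlgebra k (Fin g)) (PtMod Y) := by
  obtain ⟨r, n, B, hB⟩ := hY
  obtain ⟨e⟩ := hB.nonempty_equiv
  have := fun a => (hB.1 a).isSimpleModule
  exact .congr e

lemma IsIrredDecomp.hom_eq_zero {Y : Point k g s} {Y' : Point k g s'}
    {r r' : ℕ} {n : Fin r → ℕ} {n' : Fin r' → ℕ}
    {B : ∀ a, Point k g (n a)} {B' : ∀ a, Point k g (n' a)}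
    (hB : IsIrredDecomp Y B) (hB' : IsIrredDecomp Y' B')
    (hns : ∀ a a', ¬ Similar (B a) (B' a'))
    (φ : PtMod Y →ₗ[FreeAlgebra k (Fin g)] PtMod Y') : φ = 0 := by
  obtain ⟨e⟩ := hB.nonempty_equiv
  obtain ⟨e'⟩ := hB'.nonempty_equiv
  have hψ : e'.toLinearMap ∘ₗ φ ∘ₗ e.symm.toLinearMap = 0 := by
    refine LinearMap.pi_ext' fun a => LinearMap.ext fun x => funext fun a' => ?_
    let χ : PtMod (B a) →ₗ[FreeAlgebra k (Fin g)] PtMod (B' a') :=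
      LinearMap.proj a' ∘ₗ (e'.toLinearMap ∘ₗ φ ∘ₗ e.symm.toLinearMap) ∘ₗ
        LinearMap.single (FreeAlgebra k (Fin g)) (fun a => PtMod (B a)) a
    have := (hB.1 a).isSimpleModule
    have := (hB'.1 a').isSimpleModule
    rcases LinearMap.bijective_or_eq_zero χ with hχ | hχ
    · exact absurd (similar_of_intertwines (E := LinearEquiv.ofBijective (toLin χ) hχ)
        (intertwines_toLin χ)) (hns a a')
    · exact LinearMap.congr_fun hχ x
  ext w
  simpa using LinearMap.congr_fun hψ (e w)

lemma Separated.hom_eq_zero {h : ℕ} {s : Fin h → ℕ} {Y : ∀ i, Point k g (s i)} (hsep : Separated Y)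
    (hY : ∀ i, IsSemisimplePoint (Y i)) {i i' : Fin h} (hi : i ≠ i')
    (φ : PtMod (Y i) →ₗ[FreeAlgebra k (Fin g)] PtMod (Y i')) : φ = 0 := by
  obtain ⟨r, n, B, hB⟩ := hY i
  obtain ⟨r', n', B', hB'⟩ := hY i'
  exact hB.hom_eq_zero hB' (hsep i i' hi r r' n n' B B' hB hB') φ

/-- The matrix of an endomorphism of the module of a point. -/
noncomputable def endMatrix {Y : Point k g s} (φ : Module.End (FreeAlgebra k (Fin g)) (PtMod Y)) :
    Matrix (Fin s) (Fin s) k :=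
  LinearMap.toMatrix' (toLin φ)

lemma of_endMatrix_mulVec {Y : Point k g s} (φ : Module.End (FreeAlgebra k (Fin g)) (PtMod Y))
    (v : Fin s → k) : of (pointOp Y) ((endMatrix φ).mulVec v) = φ (of _ v) := by
  rw [← of_toLin, endMatrix, LinearMap.toMatrix'_mulVec]

lemma endMatrix_mul_comm {Y : Point k g s} (φ : Module.End (FreeAlgebra k (Fin g)) (PtMod Y))
    (j : Fin g) : endMatrix φ * Y j = Y j * endMatrix φ :=
  Matrix.toLin'.injective (LinearMap.ext fun v => by
    simpa [endMatrix, Matrix.toLin'_mul] using intertwines_toLin φ j v)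

end PointModules

section SemisimpleModules

variable {A M N : Type*} [Ring A] [AddCommGroup M] [Module A M] [AddCommGroup N] [Module A N]

lemma exists_comp_comp_eq_self [IsSemisimpleModule A M] [IsSemisimpleModule A N] (f : N →ₗ[A] M) :
    ∃ σ : M →ₗ[A] N, ∀ x, f (σ (f x)) = f x := by
  obtain ⟨r, hr⟩ := IsSemisimpleModule.lifting_property f.rangeRestrict
    f.surjective_rangeRestrict LinearMap.id
  obtain ⟨π, hπ⟩ := IsSemisimpleModule.extension_property f.range.subtype
    f.range.injective_subtype LinearMap.id
  refine ⟨r ∘ₗ π, fun x => ?_⟩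
  have hfr : ∀ y : f.range, f (r y) = y := fun y => congrArg Subtype.val (LinearMap.congr_fun hr y)
  have hπf : π (f x) = f.rangeRestrict x := LinearMap.congr_fun hπ (f.rangeRestrict x)
  rw [LinearMap.comp_apply, hfr, hπf]
  rfl

lemma mem_of_forall_end_fixing [IsSemisimpleModule A M] {W : Submodule A M} {y : M}
    (hy : ∀ π : Module.End A M, (∀ w ∈ W, π w = w) → π y = y) : y ∈ W := by
  obtain ⟨π, hπ⟩ := IsSemisimpleModule.extension_property W.subtype W.injective_subtype
    LinearMap.id
  rw [← hy (W.subtype ∘ₗ π) fun w hw => congrArg Subtype.val (LinearMap.congr_fun hπ ⟨w, hw⟩)]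
  exact (π y).2

lemma isSemisimpleModule_of_forall_smul_eq_zero [IsSemisimpleModule A M] (e : M)
    (he : ∀ a : A, a • e = 0 → ∀ x : N, a • x = 0) : IsSemisimpleModule A N := by
  let φ := LinearMap.toSpanSingleton A M e
  have : IsSemisimpleModule A (A ⧸ φ.ker) := .congr φ.quotKerEquivRange
  let ψ : N → (A ⧸ φ.ker) →ₗ[A] N := fun x =>
    φ.ker.liftQ (LinearMap.toSpanSingleton A N x) fun a ha => he a ha x
  refine isSemisimpleModule_of_isSemisimpleModule_submodule' (p := fun x => (ψ x).range)
    (fun x => .range _) (eq_top_iff.mpr fun x _ => Submodule.mem_iSup_of_mem x ⟨φ.ker.mkQ 1, ?_⟩)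
  exact (φ.ker.liftQ_apply _ 1).trans (one_smul A x)

end SemisimpleModules

section FirstOrderDeformations

variable {k σ W W' : Type*} [Field k] [AddCommGroup W] [Module k W] [AddCommGroup W'] [Module k W']

/-- The block upper triangular tuple of endomorphisms `(X, Z; 0, X')` of `W × W'`. -/
def extOp (X : σ → Module.End k W) (Z : σ → W' →ₗ[k] W) (X' : σ → Module.End k W') (j : σ) :
    Module.End k (W × W') :=
  (X j ∘ₗ LinearMap.fst k W W' + Z j ∘ₗ LinearMap.snd k W W').prod (X' j ∘ₗ LinearMap.snd k W W')

@[simp] lemma extOp_apply (X : σ → Module.End k W) (Z : σ → W' →ₗ[k] W)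
    (X' : σ → Module.End k W') (j : σ) (w : W × W') :
    extOp X Z X' j w = (X j w.1 + Z j w.2, X' j w.2) := rfl

open OpModule

variable {g s : ℕ} {ι : Type*} [Fintype ι]

/-- The extension of the power `(k^s)^ι` of the module of `Y` by the module of `Y` itself, in the
directions `Z`. -/
def deform (Y : Point k g s) (Z : ι → Point k g s) :
    Fin g → Module.End k ((Fin s → k) × (ι → Fin s → k)) :=
  extOp (pointOp Y) (fun j => ∑ i, pointOp (Z i) j ∘ₗ LinearMap.proj i) (piOp fun _ => pointOp Y)

lemma act_deform (Y : Point k g s) (Z : ι → Point k g s) (p : FreeAlgebra k (Fin g))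
    (w : (Fin s → k) × (ι → Fin s → k)) :
    act (deform Y Z) p w
      = ((evalHom Y p).mulVec w.1 + ∑ i, (derivAt Y (Z i) p).mulVec (w.2 i),
          fun i => (evalHom Y p).mulVec (w.2 i)) := by
  induction p generalizing w with
  | grade0 c =>
    simp only [derivAt_algebraMap, Matrix.zero_mulVec, Finset.sum_const_zero]
    ext <;> simp [Algebra.algebraMap_eq_smul_one, Matrix.smul_mulVec]
  | grade1 j => ext <;> simp [deform, piOp]
  | mul p q hp hq =>
    rw [map_mul, Module.End.mul_apply, hq, hp]
    simp only [derivAt_mul, map_mul, Matrix.mulVec_add, Matrix.mulVec_mulVec, Matrix.add_mulVec,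
      Finset.sum_add_distrib, Matrix.mulVec_sum, add_assoc]
  | add p q hp hq =>
    rw [map_add, LinearMap.add_apply, hp, hq]
    simp only [derivAt_add, map_add, Matrix.add_mulVec, Finset.sum_add_distrib, Prod.mk_add_mk]
    congr 1
    abel

/-- The quotient map from the deformation module to the power of the module of `Y`. -/
noncomputable def deformSnd (Y : Point k g s) (Z : ι → Point k g s) :
    OpModule (deform Y Z) →ₗ[FreeAlgebra k (Fin g)] (ι → PtMod Y) :=
  (piEquiv fun _ : ι => pointOp Y).toLinearMap ∘ₗ
    homOfIntertwines (S := LinearMap.snd k _ _) fun _ _ => rfl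

lemma evalHom_eq_zero_of_forall_smul_single {Y : Point k g s} {p : FreeAlgebra k (Fin g)}
    (hp : ∀ i, p • of (pointOp Y) (Pi.single i 1) = 0) : evalHom Y p = 0 := by
  refine Matrix.ext_of_mulVec_single fun i => ?_
  rw [evalHom_mulVec, Matrix.zero_mulVec]
  exact hp i

lemma isSemisimpleModule_span_deform {Y : Point k g s}
    [IsSemisimpleModule (FreeAlgebra k (Fin g)) (PtMod Y)] {Z : ι → Point k g s}
    {Θ : Set (ι → Fin s → k)}
    (hΘ : ∀ p, evalHom Y p = 0 → ∀ θ ∈ Θ, ∑ i, (derivAt Y (Z i) p).mulVec (θ i) = 0) :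
    IsSemisimpleModule (FreeAlgebra k (Fin g)) (Submodule.span (FreeAlgebra k (Fin g))
      ((fun θ => of (deform Y Z) (0, θ)) '' Θ)) := by
  refine isSemisimpleModule_of_forall_smul_eq_zero
    (fun i : Fin s => of (pointOp Y) (Pi.single i 1)) fun p hp x => Subtype.ext ?_
  replace hp := evalHom_eq_zero_of_forall_smul_single (congrFun hp)
  obtain ⟨x, hx⟩ := x
  change p • x = 0
  induction hx using Submodule.span_induction generalizing p with
  | mem x hx =>
    obtain ⟨θ, hθ, rfl⟩ := hx
    rw [smul_of, act_deform, hp, hΘ p hp θ hθ]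
    simp only [Matrix.zero_mulVec, add_zero]
    exact map_zero (of _)
  | zero => rw [smul_zero]
  | add x y _ _ hx hy => rw [smul_add, hx p hp, hy p hp, add_zero]
  | smul a x _ hx => rw [← mul_smul]; exact hx _ (by rw [map_mul, hp, zero_mul])

lemma exists_matrices_of_hom_deform {Y : Point k g s} {Z : ι → Point k g s}
    (φ : PtMod Y →ₗ[FreeAlgebra k (Fin g)] OpModule (deform Y Z)) :
    ∃ P : ι → Matrix (Fin s) (Fin s) k, ∃ τ : Matrix (Fin s) (Fin s) k,
      (∀ v l, deformSnd Y Z (φ (of _ v)) l = of _ ((P l).mulVec v)) ∧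
      (∀ l j, P l * Y j = Y j * P l) ∧ ∑ l, rmul (Z l) (P l) = bracket τ Y := by
  refine ⟨fun l => endMatrix (LinearMap.proj l ∘ₗ deformSnd Y Z ∘ₗ φ),
    LinearMap.toMatrix' (LinearMap.fst k _ _ ∘ₗ toLin φ), fun v l => ?_,
    fun l j => endMatrix_mul_comm _ j, ?_⟩
  · rw [of_endMatrix_mulVec]; rfl
  · funext j
    refine Matrix.toLin'.injective (LinearMap.ext fun v => ?_)
    have hφ := congrArg Prod.fst (intertwines_toLin φ j v)
    simp only [deform, extOp_apply, pointOp_apply, LinearMap.sum_apply, LinearMap.comp_apply,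
      LinearMap.proj_apply] at hφ
    have hP : ∀ l, (endMatrix (LinearMap.proj l ∘ₗ deformSnd Y Z ∘ₗ φ)).mulVec v
        = (toLin φ v).2 l := fun l => of_endMatrix_mulVec _ v
    simp only [bracket, Finset.sum_apply, rmul, map_sum, map_sub, LinearMap.sub_apply,
      LinearMap.sum_apply, Matrix.toLin'_mul, LinearMap.comp_apply, Matrix.toLin'_toMatrix',
      Matrix.toLin'_apply, LinearMap.fst_apply, hP]
    exact (sub_eq_of_eq_add' hφ).symm

-- The family `θ` is fixed by the projection that a quasi-inverse of `deformSnd` on the semisimple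
-- span of the vectors `(0, θ)` provides.
lemma exists_balanced_of_deriv_eq_zero {Y : Point k g s}
    [IsSemisimpleModule (FreeAlgebra k (Fin g)) (PtMod Y)] {Z : ι → Point k g s}
    {Θ : Set (ι → Fin s → k)}
    (hΘ : ∀ p, evalHom Y p = 0 → ∀ θ ∈ Θ, ∑ i, (derivAt Y (Z i) p).mulVec (θ i) = 0) :
    ∃ (P : ι → ι → Matrix (Fin s) (Fin s) k) (τ : ι → Matrix (Fin s) (Fin s) k),
      (∀ l i j, P l i * Y j = Y j * P l i) ∧
      (∀ θ ∈ Θ, ∀ l, ∑ i, (P l i).mulVec (θ i) = θ l) ∧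
      ∀ i, ∑ l, rmul (Z l) (P l i) = bracket (τ i) Y := by
  classical
  have := isSemisimpleModule_span_deform hΘ
  set N := Submodule.span (FreeAlgebra k (Fin g)) ((fun θ => of (deform Y Z) (0, θ)) '' Θ)
  obtain ⟨σ, hσ⟩ := exists_comp_comp_eq_self (deformSnd Y Z ∘ₗ N.subtype)
  choose P τ hval hcomm hbracket using fun i => exists_matrices_of_hom_deform
    (N.subtype ∘ₗ σ ∘ₗ LinearMap.single (FreeAlgebra k (Fin g)) (fun _ => PtMod Y) i)
  refine ⟨fun l i => P i l, τ, fun l i => hcomm i l, fun θ hθ l => ?_, hbracket⟩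
  have hθN : of (deform Y Z) (0, θ) ∈ N := Submodule.subset_span ⟨θ, hθ, rfl⟩
  have hσθ : deformSnd Y Z (σ fun i => of (pointOp Y) (θ i)) = fun i => of (pointOp Y) (θ i) :=
    hσ ⟨_, hθN⟩
  apply (of (pointOp Y)).injective
  calc of (pointOp Y) (∑ i, (P i l).mulVec (θ i))
      = ∑ i, deformSnd Y Z (σ (Pi.single i (of (pointOp Y) (θ i)))) l := by
        simp only [map_sum, ← hval]; rfl
    _ = deformSnd Y Z (σ fun i => of (pointOp Y) (θ i)) l := by
        rw [← Finset.univ_sum_single fun i => of (pointOp Y) (θ i)]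
        simp
    _ = of (pointOp Y) (θ l) := congrFun hσθ l

end FirstOrderDeformations

section OnePoint

variable {k : Type*} [Field k] {g s m : ℕ}

/-- Left multiplication by `S` of `(Z^1, …, Z^m, η)`, where `η` is a vector: it multiplies `Z^1`,
or the vector `η` if `m = 0`. -/
def leftMul (S : Matrix (Fin s) (Fin s) k) :
    ∀ {m : ℕ}, (Fin m → Point k g s) × (Fin s → k) → (Fin m → Point k g s) × (Fin s → k)
  | 0, x => (x.1, S.mulVec x.2)
  | _ + 1, x => (Function.update x.1 0 (lmul S (x.1 0)), x.2)

lemma mulVec_leftMul {S : Matrix (Fin s) (Fin s) k} {x : (Fin m → Point k g s) × (Fin s → k)}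
    {F : MultiMap k g s m} (hF : gapComm 0 S x.1 F = 0) :
    (F (leftMul S x).1).mulVec (leftMul S x).2 = S.mulVec ((F x.1).mulVec x.2) := by
  simp only [gapComm, LinearMap.coe_mk, AddHom.coe_mk, gapLeft_zero, sub_eq_zero] at hF
  rw [Matrix.mulVec_mulVec, hF]
  cases m with
  | zero =>
    have h0 : (0 : Fin (0 + 1)) = Fin.last 0 := rfl
    rw [h0, gapRight_last, ← Matrix.mulVec_mulVec]
    rfl
  | succ m =>
    have h0 : (0 : Fin (m + 1 + 1)) = (0 : Fin (m + 1)).castSucc := rfl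
    rw [h0, gapRight_castSucc]
    rfl

lemma mulVec_cons_leftMul {S : Matrix (Fin s) (Fin s) k} {z : Point k g s}
    {x : (Fin m → Point k g s) × (Fin s → k)} {G : MultiMap k g s (m + 1)}
    (hG : gapComm 1 S (Fin.cons z x.1) G = 0) :
    (G (Fin.cons z (leftMul S x).1)).mulVec (leftMul S x).2
      = (G (Fin.cons (rmul z S) x.1)).mulVec x.2 := by
  have h1 : (1 : Fin (m + 1 + 1)) = (0 : Fin (m + 1)).succ := rfl
  simp only [gapComm, LinearMap.coe_mk, AddHom.coe_mk, sub_eq_zero] at hG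
  rw [h1, gapLeft_succ, Fin.cons_zero, Fin.update_cons_zero] at hG
  rw [hG]
  cases m with
  | zero =>
    have h0 : (0 : Fin (0 + 1)).succ = Fin.last 1 := rfl
    rw [h0, gapRight_last, ← Matrix.mulVec_mulVec]
    rfl
  | succ m =>
    have h0 : (0 : Fin (m + 1 + 1)).succ = (0 : Fin (m + 1)).succ.castSucc := rfl
    rw [h0, gapRight_castSucc, Fin.cons_succ, ← Fin.cons_update]
    rfl

/-- Multilinear maps that vanish on brackets with `Y` and are balanced over the centralizer of `Y`
in all gaps but the one in front of the first argument. -/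
structure IsBalanced (Y : Point k g s) (G : MultiMap k g s m) : Prop where
  map_bracket : ∀ Z i S, Z i = bracket S Y → G Z = 0
  gapComm_succ : ∀ (t : Fin m) S, (∀ j, S * Y j = Y j * S) → ∀ Z, gapComm t.succ S Z G = 0

lemma IsBalanced.curryLeft {Y : Point k g s} {G : MultiMap k g s (m + 1)} (hG : IsBalanced Y G)
    (z : Point k g s) : IsBalanced Y (G.curryLeft z) where
  map_bracket Z i S hZ := hG.map_bracket (Fin.cons z Z) i.succ S (by rwa [Fin.cons_succ])
  gapComm_succ t S hS Z := by
    have hgap := hG.gapComm_succ t.succ S hS (Fin.cons z Z)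
    simp only [gapComm, LinearMap.coe_mk, AddHom.coe_mk, sub_eq_zero, gapLeft_succ, Fin.cons_succ,
      MultilinearMap.curryLeft_apply, ← Fin.cons_update] at hgap ⊢
    rw [hgap]
    cases m with
    | zero => exact t.elim0
    | succ m =>
      cases t using Fin.lastCases with
      | last => rw [Fin.succ_last, Fin.succ_last, gapRight_last, gapRight_last]; rfl
      | cast i =>
        rw [Fin.succ_castSucc, Fin.succ_castSucc, gapRight_castSucc, gapRight_castSucc,
          Fin.cons_succ, ← Fin.cons_update]
        rfl

/-- Every linear relation that the leading coefficients at `Y` of polynomials of vanishing order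
at least `m` satisfy is also satisfied by `G`. -/
def IsDeterminedByLeading (Y : Point k g s) (G : MultiMap k g s m) : Prop :=
  ∀ (ι : Type) [Fintype ι] (x : ι → (Fin m → Point k g s) × (Fin s → k)),
    (∀ p, polyDiff Y p ∈ vanishBelow k g s m →
      ∑ l, (polyDiff Y p m (x l).1).mulVec (x l).2 = 0) →
    ∑ l, (G (x l).1).mulVec (x l).2 = 0

lemma IsDeterminedByLeading.eq_sum {Y : Point k g s} {G : MultiMap k g s m}
    (hG : IsDeterminedByLeading Y G) {ι : Type} [Fintype ι]
    {x₀ : (Fin m → Point k g s) × (Fin s → k)} {x : ι → (Fin m → Point k g s) × (Fin s → k)}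
    (hx : ∀ p, polyDiff Y p ∈ vanishBelow k g s m →
      (polyDiff Y p m x₀.1).mulVec x₀.2 = ∑ i, (polyDiff Y p m (x i).1).mulVec (x i).2) :
    (G x₀.1).mulVec x₀.2 = ∑ i, (G (x i).1).mulVec (x i).2 := by
  have hsum := hG (Option ι) (fun o => o.elim (x₀.1, -x₀.2) x) fun p hp => by
    simp [Fintype.sum_option, Matrix.mulVec_neg, hx p hp]
  simpa only [Fintype.sum_option, Option.elim_none, Option.elim_some, Matrix.mulVec_neg,
    neg_add_eq_zero] using hsum

lemma polyDiff_mul_mem_vanishBelow {Y : Point k g s} {p q : FreeAlgebra k (Fin g)}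
    (hq : evalHom Y q = 0) (hp : polyDiff Y p ∈ vanishBelow k g s m) :
    polyDiff Y (q * p) ∈ vanishBelow k g s (m + 1) := by
  intro ℓ hℓ
  rw [polyDiff_mul]
  rcases Nat.lt_succ_iff_lt_or_eq.mp hℓ with h | rfl
  · exact (isInvariant_vanishBelow Y m).act_mem q hp ℓ h
  · exact MultilinearMap.ext fun Z => by rw [act_varMul_leading Y q hp, hq, zero_mul]; rfl

lemma IsDeterminedByLeading.of_curryLeft {Y : Point k g s}
    [IsSemisimpleModule (FreeAlgebra k (Fin g)) (PtMod Y)] {G : MultiMap k g s (m + 1)}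
    (hG : IsBalanced Y G) (ih : ∀ z, IsDeterminedByLeading Y (G.curryLeft z)) :
    IsDeterminedByLeading Y G := by
  intro ι _ x hx
  let xt : ι → (Fin m → Point k g s) × (Fin s → k) := fun l => (Fin.tail (x l).1, (x l).2)
  obtain ⟨P, τ, hcomm, hfix, hbracket⟩ := exists_balanced_of_deriv_eq_zero (Y := Y)
    (Z := fun l => (x l).1 0) (Θ := {θ | ∃ p, polyDiff Y p ∈ vanishBelow k g s m ∧
      θ = fun l => (polyDiff Y p m (xt l).1).mulVec (xt l).2}) (by
    rintro q hq _ ⟨p, hp, rfl⟩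
    rw [← hx (q * p) (polyDiff_mul_mem_vanishBelow hq hp)]
    refine Finset.sum_congr rfl fun l _ => ?_
    rw [polyDiff_mul, act_varMul_next Y q hp, hq, zero_mul, zero_add, Matrix.mulVec_mulVec])
  have hval : ∀ l, (G (x l).1).mulVec (x l).2
      = ∑ i, (G (Fin.cons (rmul ((x l).1 0) (P l i)) (xt i).1)).mulVec (x i).2 := by
    intro l
    have hl := (ih ((x l).1 0)).eq_sum (x₀ := xt l) (x := fun i => leftMul (P l i) (xt i))
      fun p hp => by
        rw [← hfix _ ⟨p, hp, rfl⟩ l]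
        exact Finset.sum_congr rfl fun i _ => (mulVec_leftMul (gapComm_eq_zero_of_mem_lacSubmodule
          (polyDiff_mem_lacSubmodule Y p) (hcomm l i) 0 _)).symm
    simp only [MultilinearMap.curryLeft_apply] at hl
    rw [← Fin.cons_self_tail (x l).1, hl]
    exact Finset.sum_congr rfl fun i _ =>
      mulVec_cons_leftMul (hG.gapComm_succ 0 _ (hcomm l i) _)
  calc ∑ l, (G (x l).1).mulVec (x l).2
      = ∑ i, (G.curryLeft (∑ l, rmul ((x l).1 0) (P l i)) (xt i).1).mulVec (x i).2 := by
        rw [Finset.sum_congr rfl fun l _ => hval l, Finset.sum_comm]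
        simp only [map_sum, sum_apply, Matrix.sum_mulVec, MultilinearMap.curryLeft_apply]
    _ = 0 := Finset.sum_eq_zero fun i _ => by
        rw [hbracket, MultilinearMap.curryLeft_apply, hG.map_bracket _ 0 (τ i) rfl,
          Matrix.zero_mulVec]

lemma IsBalanced.isDeterminedByLeading {Y : Point k g s}
    [IsSemisimpleModule (FreeAlgebra k (Fin g)) (PtMod Y)] {G : MultiMap k g s m}
    (hG : IsBalanced Y G) : IsDeterminedByLeading Y G := by
  induction m with
  | zero =>
    intro ι _ x hx
    have hsum : ∑ l, (x l).2 = 0 := by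
      simpa [polyDiff_zero_apply] using hx 1 (mem_vanishBelow_zero _)
    simp only [Subsingleton.elim (x _).1 Fin.elim0, ← Matrix.mulVec_sum, hsum, Matrix.mulVec_zero]
  | succ m ih => exact .of_curryLeft hG fun z => ih (hG.curryLeft z)

/-- The polynomials of vanishing order at least `m` at `Y`, as a left ideal. -/
noncomputable def vanishingIdeal (Y : Point k g s) (m : ℕ) : Ideal (FreeAlgebra k (Fin g)) where
  carrier := {p | polyDiff Y p ∈ vanishBelow k g s m}
  add_mem' {p q} hp hq := by
    change polyDiff Y (p + q) ∈ vanishBelow k g s m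
    rw [map_add]
    exact add_mem hp hq
  zero_mem' := by
    change polyDiff Y 0 ∈ vanishBelow k g s m
    rw [map_zero]
    exact zero_mem _
  smul_mem' q p hp := by
    change polyDiff Y (q * p) ∈ vanishBelow k g s m
    rw [polyDiff_mul]
    exact (isInvariant_vanishBelow Y m).act_mem q hp

open OpModule in
/-- The leading coefficient of polynomials of vanishing order at least `m` at `Y`, evaluated at
matrices `Z^1, …, Z^m` and a vector. -/
noncomputable def leadingHom (Y : Point k g s) (x : (Fin m → Point k g s) × (Fin s → k)) :
    vanishingIdeal Y m →ₗ[FreeAlgebra k (Fin g)] PtMod Y where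
  toFun p := of (pointOp Y) ((polyDiff Y p.1 m x.1).mulVec x.2)
  map_add' p q := by simp [Matrix.add_mulVec]
  map_smul' q p := by
    rw [Submodule.coe_smul, smul_eq_mul, polyDiff_mul, act_varMul_leading Y q p.2,
      ← Matrix.mulVec_mulVec, evalHom_mulVec]
    rfl

open OpModule in
lemma IsDeterminedByLeading.mem_range_leadingHom {Y : Point k g s}
    [IsSemisimpleModule (FreeAlgebra k (Fin g)) (PtMod Y)] {G : MultiMap k g s m}
    (hG : IsDeterminedByLeading Y G)
    (hgap : ∀ S, (∀ j, S * Y j = Y j * S) → ∀ Z, gapComm 0 S Z G = 0) {ι : Type} [Finite ι]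
    (x : ι → (Fin m → Point k g s) × (Fin s → k)) :
    (fun l => of (pointOp Y) ((G (x l).1).mulVec (x l).2))
      ∈ (LinearMap.pi fun l => leadingHom Y (x l)).range := by
  classical
  have := Fintype.ofFinite ι
  refine mem_of_forall_end_fixing fun π hπ => ?_
  let P : ι → ι → Matrix (Fin s) (Fin s) k := fun l i => endMatrix
    (LinearMap.proj l ∘ₗ π ∘ₗ LinearMap.single (FreeAlgebra k (Fin g)) (fun _ => PtMod Y) i)
  have hcomm : ∀ l i j, P l i * Y j = Y j * P l i := fun l i j => endMatrix_mul_comm _ j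
  have hP : ∀ (v : ι → Fin s → k) l,
      of (pointOp Y) (∑ i, (P l i).mulVec (v i)) = π (fun i => of _ (v i)) l := by
    intro v l
    rw [← Finset.univ_sum_single fun i => of (pointOp Y) (v i)]
    simp only [map_sum, P, of_endMatrix_mulVec, Finset.sum_apply]
    rfl
  funext l
  rw [← hP, hG.eq_sum (x₀ := x l) (x := fun i => leftMul (P l i) (x i))]
  · simp only [mulVec_leftMul (hgap _ (hcomm l _) _)]
  · intro p hp
    apply (of (pointOp Y)).injective
    simp only [mulVec_leftMul (gapComm_eq_zero_of_mem_lacSubmodule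
      (polyDiff_mem_lacSubmodule Y p) (hcomm l _) 0 _), hP]
    exact (congrFun (hπ _ ⟨⟨p, hp⟩, rfl⟩) l).symm

lemma exists_polyDiff_eq_of_gapComm_eq_zero (Y : Point k g s)
    [IsSemisimpleModule (FreeAlgebra k (Fin g)) (PtMod Y)] {L : ℕ} (G : MultiMap k g s L)
    (hbracket : ∀ Z i S, Z i = bracket S Y → G Z = 0)
    (hgap : ∀ (t : Fin (L + 1)) S, (∀ j, S * Y j = Y j * S) → ∀ Z, gapComm t S Z G = 0) :
    ∃ p, polyDiff Y p ∈ vanishBelow k g s L ∧ polyDiff Y p L = G := by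
  have hG : IsBalanced Y G := ⟨hbracket, fun t => hgap t.succ⟩
  let b := Module.finBasis k (Point k g s)
  obtain ⟨⟨p, hp⟩, hpG⟩ := hG.isDeterminedByLeading.mem_range_leadingHom (hgap 0)
    fun i : (Fin L → Fin (Module.finrank k (Point k g s))) × Fin s =>
      (fun t => b (i.1 t), Pi.single i.2 1)
  refine ⟨p, hp, Module.Basis.ext_multilinear (fun _ => b) fun v => ?_⟩
  exact Matrix.ext_of_mulVec_single fun i => congrFun hpG (v, i)

theorem exists_polyDiff_eq (Y : Point k g s)
    [IsSemisimpleModule (FreeAlgebra k (Fin g)) (PtMod Y)] {L : ℕ} {F : Seq k g s}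
    (hF : TruncLAC Y L F) : ∃ p, ∀ ℓ ≤ L, polyDiff Y p ℓ = F ℓ := by
  induction L with
  | zero =>
    obtain ⟨p, -, hp⟩ := exists_polyDiff_eq_of_gapComm_eq_zero Y (F 0) (fun _ i => i.elim0)
      fun t S hS Z => sub_eq_zero.mpr (hF.2 t S hS Z)
    exact ⟨p, fun ℓ hℓ => by rwa [Nat.le_zero.mp hℓ]⟩
  | succ L ih =>
    obtain ⟨hbracket, hgap⟩ := hF
    obtain ⟨p, hp⟩ := ih ⟨fun m hm => hbracket m (by omega), fun t S hS Z => by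
      have h := hbracket L (by omega) t S Z
      rw [bracket_eq_zero hS, MultilinearMap.map_coord_zero _ t (by simp)] at h
      exact sub_eq_zero.mp h.symm⟩
    have hpLAC := polyDiff_mem_lacSubmodule Y p
    obtain ⟨q, hq0, hq⟩ := exists_polyDiff_eq_of_gapComm_eq_zero Y
      (F (L + 1) - polyDiff Y p (L + 1))
      (fun Z i S hZ => by
        have hFZ := hbracket L (by omega) i S (i.removeNth Z)
        have hpZ := hpLAC L i S (i.removeNth Z)
        rw [← hZ, Fin.insertNth_self_removeNth] at hFZ hpZ
        rw [sub_apply, hFZ, hpZ, hp L le_rfl]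
        exact sub_self _)
      fun t S hS Z => by
        rw [map_sub, gapComm_eq_zero_of_mem_lacSubmodule hpLAC hS, sub_zero]
        exact sub_eq_zero.mpr (hgap t S hS Z)
    refine ⟨p + q, fun ℓ hℓ => ?_⟩
    rw [map_add, Pi.add_apply]
    rcases Nat.le_succ_iff_eq_or_le.mp hℓ with rfl | h
    · rw [hq, add_sub_cancel]
    · rw [hp ℓ h, hq0 ℓ (by omega), add_zero]

end OnePoint

section SeparatedPoints

open OpModule

lemma single_mem_of_hom_eq_zero {A ι : Type*} [Ring A] [Finite ι] [DecidableEq ι] {M : ι → Type*}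
    [∀ i, AddCommGroup (M i)] [∀ i, Module A (M i)] [∀ i, IsSemisimpleModule A (M i)]
    (hM : ∀ i i', i ≠ i' → ∀ φ : M i →ₗ[A] M i', φ = 0) {W : Submodule A (∀ i, M i)}
    {x : ∀ i, M i} (hx : x ∈ W) (i : ι) : Pi.single i (x i) ∈ W := by
  have := Fintype.ofFinite ι
  refine mem_of_forall_end_fixing fun π hπ => ?_
  have hoff : ∀ j i', j ≠ i' → ∀ y, π (Pi.single j y) i' = 0 := fun j i' hj y =>
    LinearMap.congr_fun (hM j i' hj (LinearMap.proj i' ∘ₗ π ∘ₗ LinearMap.single A M j)) y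
  funext i'
  rcases eq_or_ne i i' with rfl | hi
  · rw [Pi.single_eq_same]
    calc π (Pi.single i (x i)) i
        = ∑ j, π (Pi.single j (x j)) i :=
          (Finset.sum_eq_single i (fun j _ hj => hoff j i hj _) (by simp)).symm
      _ = π x i := by rw [← Finset.sum_apply, ← map_sum, Finset.univ_sum_single]
      _ = x i := by rw [hπ x hx]
  · rw [hoff i i' hi, Pi.single_eq_of_ne hi.symm]

variable {k : Type*} [Field k] {g h : ℕ} {s : Fin h → ℕ} {Y : ∀ i, Point k g (s i)}

lemma exists_evalHom_eq_one_and_eq_zero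
    [∀ i, IsSemisimpleModule (FreeAlgebra k (Fin g)) (PtMod (Y i))]
    (hom_zero : ∀ i i', i ≠ i' → ∀ φ : PtMod (Y i) →ₗ[FreeAlgebra k (Fin g)] PtMod (Y i'), φ = 0)
    (i : Fin h) : ∃ u, evalHom (Y i) u = 1 ∧ ∀ i', i' ≠ i → evalHom (Y i') u = 0 := by
  let x : ∀ i, Fin (s i) → PtMod (Y i) := fun i b => of (pointOp (Y i)) (Pi.single b 1)
  have hpow : ∀ i i', i ≠ i' → ∀ φ : (Fin (s i) → PtMod (Y i)) →ₗ[FreeAlgebra k (Fin g)]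
      (Fin (s i') → PtMod (Y i')), φ = 0 := fun i i' hi φ =>
    LinearMap.pi_ext' fun b => LinearMap.ext fun y => funext fun b' =>
      LinearMap.congr_fun (hom_zero i i' hi (LinearMap.proj b' ∘ₗ φ ∘ₗ
        LinearMap.single _ (fun _ => PtMod (Y i)) b)) y
  obtain ⟨u, hu⟩ := Submodule.mem_span_singleton.mp
    (single_mem_of_hom_eq_zero hpow (Submodule.mem_span_singleton_self x) i)
  refine ⟨u, ?_, fun i' hi' => evalHom_eq_zero_of_forall_smul_single fun b => ?_⟩
  · refine Matrix.ext_of_mulVec_single fun b => ?_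
    have hb := congrFun (congrFun hu i) b
    rw [Pi.single_eq_same] at hb
    rw [evalHom_mulVec, Matrix.one_mulVec]
    exact hb
  · have hb := congrFun (congrFun hu i') b
    rw [Pi.single_eq_of_ne hi'] at hb
    exact hb

lemma polyDiff_pow_mul_mem_vanishBelow {n : ℕ} {Y : Point k g n} {u : FreeAlgebra k (Fin g)}
    (hu : evalHom Y u = 0) (N : ℕ) (p : FreeAlgebra k (Fin g)) :
    polyDiff Y (u ^ N * p) ∈ vanishBelow k g n N := by
  induction N with
  | zero => exact mem_vanishBelow_zero _
  | succ N ih =>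
    rw [pow_succ', mul_assoc]
    exact polyDiff_mul_mem_vanishBelow hu ih

-- If `u` is `1` at `Y i` and `0` at the other points, then `1 - (1 - u ^ N) ^ N` has the same
-- values to order `N`: it is divisible by `u ^ N`, and `1 - u ^ N` vanishes at `Y i`.
lemma exists_polyDiff_mul_eq_and_eq_zero
    [∀ i, IsSemisimpleModule (FreeAlgebra k (Fin g)) (PtMod (Y i))]
    (hom_zero : ∀ i i', i ≠ i' → ∀ φ : PtMod (Y i) →ₗ[FreeAlgebra k (Fin g)] PtMod (Y i'), φ = 0)
    (N : ℕ) (i : Fin h) :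
    ∃ e, ∀ p, (∀ ℓ < N, polyDiff (Y i) (e * p) ℓ = polyDiff (Y i) p ℓ) ∧
      ∀ i', i' ≠ i → ∀ ℓ < N, polyDiff (Y i') (e * p) ℓ = 0 := by
  obtain ⟨u, hu1, hu0⟩ := exists_evalHom_eq_one_and_eq_zero hom_zero i
  refine ⟨1 - (1 - u ^ N) ^ N, fun p => ⟨fun ℓ hℓ => ?_, fun i' hi' => ?_⟩⟩
  · have hv : evalHom (Y i) (1 - u ^ N) = 0 := by simp [hu1]
    rw [sub_mul, one_mul, map_sub, Pi.sub_apply, polyDiff_pow_mul_mem_vanishBelow hv N p ℓ hℓ,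
      sub_zero]
  · obtain ⟨r, hr⟩ := (Commute.one_left (1 - u ^ N)).sub_dvd_pow_sub_pow N
    rw [one_pow, sub_sub_cancel] at hr
    rw [hr, mul_assoc]
    exact polyDiff_pow_mul_mem_vanishBelow (hu0 i' hi') N (r * p)

theorem exists_polyDiff_eq_of_separated (hY : ∀ i, IsSemisimplePoint (Y i)) (hsep : Separated Y)
    {L : ℕ} {F : ∀ i, Seq k g (s i)} (hF : ∀ i, TruncLAC (Y i) L (F i)) :
    ∃ p, ∀ i, ∀ ℓ ≤ L, polyDiff (Y i) p ℓ = F i ℓ := by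
  have := fun i => (hY i).isSemisimpleModule
  choose p hp using fun i => exists_polyDiff_eq (Y i) (hF i)
  choose e he using exists_polyDiff_mul_eq_and_eq_zero
    (fun _ _ hi => hsep.hom_eq_zero hY hi) (L + 1)
  refine ⟨∑ j, e j * p j, fun i ℓ hℓ => ?_⟩
  rw [map_sum, Finset.sum_apply, Finset.sum_eq_single i]
  · rw [(he i (p i)).1 ℓ (by omega), hp i ℓ hℓ]
  · exact fun j _ hj => (he j (p j)).2 i hj.symm ℓ (by omega)
  · simp

end SeparatedPoints

section ExtensionKernels

variable {k V V' V'' : Type*} [Field k] [AddCommGroup V] [Module k V] [AddCommGroup V']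
  [Module k V'] [AddCommGroup V''] [Module k V'']

lemma exists_comp_eq_of_ker_le_ker {f : V →ₗ[k] V'} {h : V →ₗ[k] V''}
    (hle : LinearMap.ker f ≤ LinearMap.ker h) : ∃ ψ : V' →ₗ[k] V'', ψ ∘ₗ f = h := by
  obtain ⟨r, hr⟩ := LinearMap.exists_leftInverse_of_injective ((LinearMap.ker f).liftQ f le_rfl)
    (Submodule.ker_liftQ_eq_bot _ _ _ le_rfl)
  refine ⟨(LinearMap.ker f).liftQ h hle ∘ₗ r, LinearMap.ext fun v => ?_⟩
  have hrv : r (f v) = Submodule.Quotient.mk v := LinearMap.congr_fun hr (Submodule.Quotient.mk v)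
  simp [hrv]

variable {σ W W' W₁ W₂ : Type*} [AddCommGroup W] [Module k W] [AddCommGroup W'] [Module k W']
  [AddCommGroup W₁] [Module k W₁] [AddCommGroup W₂] [Module k W₂] {U : Submodule k (W × W')}
  {S₁ : W →ₗ[k] W₁} {S₂ : W' →ₗ[k] W₂}

lemma exists_ker_coprod_prod_eq (hS₁ : LinearMap.ker S₁ = U.comap (LinearMap.inl k W W'))
    (hS₂ : LinearMap.ker S₂ = U.map (LinearMap.snd k W W')) :
    ∃ T : W' →ₗ[k] W₁,
      LinearMap.ker ((S₁.coprod T).prod (S₂ ∘ₗ LinearMap.snd k W W')) = U := by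
  have hS₁' : ∀ w, S₁ w = 0 ↔ (w, (0 : W')) ∈ U := fun w => SetLike.ext_iff.mp hS₁ w
  have hS₂' : ∀ w', S₂ w' = 0 ↔ ∃ w, (w, w') ∈ U := fun w' => by
    simpa using SetLike.ext_iff.mp hS₂ w'
  obtain ⟨T, hT⟩ := exists_comp_eq_of_ker_le_ker (f := LinearMap.snd k W W' ∘ₗ U.subtype)
    (h := -(S₁ ∘ₗ LinearMap.fst k W W' ∘ₗ U.subtype)) (by
      rintro ⟨⟨w, w'⟩, hw⟩ (rfl : w' = 0)
      simpa using (hS₁' w).mpr hw)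
  have hTU : ∀ w w', (w, w') ∈ U → S₁ w + T w' = 0 := fun w w' hw =>
    add_eq_zero_iff_neg_eq.mpr (LinearMap.congr_fun hT ⟨(w, w'), hw⟩).symm
  refine ⟨T, Submodule.ext fun ⟨w, w'⟩ => ?_⟩
  suffices h : S₁ w + T w' = 0 ∧ S₂ w' = 0 ↔ (w, w') ∈ U by simpa using h
  refine ⟨fun ⟨h₁, h₂⟩ => ?_, fun hw => ⟨hTU w w' hw, (hS₂' w').mpr ⟨w, hw⟩⟩⟩
  obtain ⟨u, hu⟩ := (hS₂' w').mp h₂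
  have hwu : (w - u, (0 : W')) ∈ U := by
    rw [← hS₁', map_sub, sub_eq_zero]
    exact add_right_cancel (h₁.trans (hTU u w' hu).symm)
  simpa using U.add_mem hwu hu

lemma exists_intertwines_extOp_ker_eq {X : σ → Module.End k W} {Z : σ → W' →ₗ[k] W}
    {X' : σ → Module.End k W'} {X₁ : σ → Module.End k W₁} {X₂ : σ → Module.End k W₂}
    (hU : IsInvariant (extOp X Z X') U) (hI₁ : Intertwines X X₁ S₁) (hI₂ : Intertwines X' X₂ S₂)
    (hS₁ : LinearMap.ker S₁ = U.comap (LinearMap.inl k W W'))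
    (hS₂ : LinearMap.ker S₂ = U.map (LinearMap.snd k W W')) :
    ∃ (Z₁ : σ → W₂ →ₗ[k] W₁) (S : W × W' →ₗ[k] W₁ × W₂),
      Intertwines (extOp X Z X') (extOp X₁ Z₁ X₂) S ∧ LinearMap.ker S = U := by
  obtain ⟨T, hT⟩ := exists_ker_coprod_prod_eq hS₁ hS₂
  have hTU : ∀ w ∈ U, S₁ w.1 + T w.2 = 0 := fun w hw =>
    congrArg Prod.fst (show _ = (0 : W₁ × W₂) from hT.ge hw)
  have hZ₁ : ∀ j, ∃ Z₁ : W₂ →ₗ[k] W₁, Z₁ ∘ₗ S₂ = S₁ ∘ₗ Z j + T ∘ₗ X' j - X₁ j ∘ₗ T := by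
    refine fun j => exists_comp_eq_of_ker_le_ker fun w' hw' => ?_
    obtain ⟨⟨w, _⟩, hw, rfl⟩ := hS₂.le hw'
    have h := hTU _ hw
    have hX := hTU _ (hU j _ hw)
    simp only [extOp_apply, map_add, hI₁ j w, eq_neg_of_add_eq_zero_left h, map_neg] at hX
    simp only [LinearMap.mem_ker, LinearMap.sub_apply, LinearMap.add_apply, LinearMap.comp_apply,
      LinearMap.snd_apply]
    rw [← hX]
    abel
  choose Z₁ hZ₁ using hZ₁
  refine ⟨Z₁, _, fun j w => Prod.ext ?_ (hI₂ j w.2), hT⟩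
  have h : Z₁ j (S₂ w.2) = S₁ (Z j w.2) + T (X' j w.2) - X₁ j (T w.2) :=
    LinearMap.congr_fun (hZ₁ j) w.2
  calc S₁ (X j w.1 + Z j w.2) + T (X' j w.2)
      = X₁ j (S₁ w.1) + S₁ (Z j w.2) + T (X' j w.2) := by rw [map_add, hI₁]
    _ = X₁ j (S₁ w.1 + T w.2) + Z₁ j (S₂ w.2) := by rw [map_add, h]; abel

end ExtensionKernels

section BlockTriangular

variable {k : Type*} [Field k] {g m n : ℕ}

variable (k m n) in
/-- Stacking two vectors. -/
def stack : ((Fin m → k) × (Fin n → k)) ≃ₗ[k] (Fin (m + n) → k) :=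
  (LinearEquiv.sumArrowLequivProdArrow (Fin m) (Fin n) k k).symm.trans
    (LinearEquiv.funCongrLeft k k finSumFinEquiv.symm)

lemma reindex_fromBlocks_mulVec_stack (A : Matrix (Fin m) (Fin m) k) (B : Matrix (Fin m) (Fin n) k)
    (C : Matrix (Fin n) (Fin m) k) (D : Matrix (Fin n) (Fin n) k)
    (v : (Fin m → k) × (Fin n → k)) :
    (Matrix.reindex finSumFinEquiv finSumFinEquiv (Matrix.fromBlocks A B C D)).mulVec
        (stack k m n v)
      = stack k m n (A.mulVec v.1 + B.mulVec v.2, C.mulVec v.1 + D.mulVec v.2) := by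
  have hstack : ∀ u : (Fin m → k) × (Fin n → k),
      stack k m n u = Sum.elim u.1 u.2 ∘ finSumFinEquiv.symm := fun _ => rfl
  rw [hstack, hstack, Matrix.reindex_apply, Matrix.submatrix_mulVec_equiv, Function.comp_assoc,
    Equiv.symm_symm, Equiv.symm_comp_self, Function.comp_id, Matrix.fromBlocks_mulVec]
  rfl

lemma intertwines_stack (X : Point k g m) (Z : Fin g → Matrix (Fin m) (Fin n) k)
    (X' : Point k g n) :
    Intertwines (extOp (pointOp X) (fun j => (Z j).mulVecLin) (pointOp X'))
      (pointOp (upperBlock X Z X')) (stack k m n).toLinearMap := by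
  intro j v
  simp [upperBlock, reindex_fromBlocks_mulVec_stack, -Matrix.reindex_apply]

end BlockTriangular

section NCFunctions

variable {k : Type*} [Field k] {g m n : ℕ} {Ω : ∀ n : ℕ, Set (Point k g n)}
  {f : ∀ n : ℕ, Point k g n → Matrix (Fin n) (Fin n) k}

lemma IsNCFunction.commute (hf : IsNCFunction Ω f) {X : Point k g n} (hX : X ∈ Ω n)
    (P : (Matrix (Fin n) (Fin n) k)ˣ) (hP : ∀ j, Commute P.val (X j)) :
    Commute P.val (f n X) := by
  have hconj : (fun j => P.val * X j * P.inv) = X := funext fun j => by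
    rw [(hP j).eq, mul_assoc, P.val_inv, mul_one]
  have hval := hf.map_similar n X P hX (hconj.symm ▸ hX)
  rw [hconj] at hval
  calc P.val * f n X = P.val * f n X * P.inv * P.val := by
        rw [mul_assoc _ P.inv, P.inv_val, mul_one]
    _ = f n X * P.val := by rw [← hval]

/-- The invertible block lower triangular matrix with identity diagonal blocks and `S` below
them. -/
def shear (S : Matrix (Fin n) (Fin m) k) : (Matrix (Fin (m + n)) (Fin (m + n)) k)ˣ where
  val := Matrix.reindex finSumFinEquiv finSumFinEquiv (Matrix.fromBlocks 1 0 S 1)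
  inv := Matrix.reindex finSumFinEquiv finSumFinEquiv (Matrix.fromBlocks 1 0 (-S) 1)
  val_inv := by simp [Matrix.submatrix_mul_equiv, Matrix.fromBlocks_multiply]
  inv_val := by simp [Matrix.submatrix_mul_equiv, Matrix.fromBlocks_multiply]

lemma commute_shear_directSum_iff {S : Matrix (Fin n) (Fin m) k} {A : Matrix (Fin m) (Fin m) k}
    {B : Matrix (Fin n) (Fin n) k} :
    Commute (shear S).val (directSum A B) ↔ S * A = B * S := by
  simp only [shear, directSum, commute_iff_eq, Matrix.reindex_apply, Matrix.submatrix_mul_equiv,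
    Matrix.fromBlocks_multiply]
  rw [← Matrix.reindex_apply, ← Matrix.reindex_apply, Equiv.apply_eq_iff_eq, Matrix.fromBlocks_inj]
  simp

lemma IsNCFunction.intertwines (hf : IsNCFunction Ω f) (hΩ : IsNCSet Ω) {X : Point k g m}
    {X' : Point k g n} (hX : X ∈ Ω m) (hX' : X' ∈ Ω n) {S : (Fin m → k) →ₗ[k] (Fin n → k)}
    (hS : Intertwines (pointOp X) (pointOp X') S) (v : Fin m → k) :
    S ((f m X).mulVec v) = (f n X').mulVec (S v) := by
  obtain ⟨S, rfl⟩ := Matrix.toLin'.surjective S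
  have hcomm := hf.commute (hΩ m n X X' hX hX') (shear S) fun j =>
    commute_shear_directSum_iff.mpr <| Matrix.ext_of_mulVec_single fun i => by
      simpa only [pointOp_apply, Matrix.toLin'_apply, Matrix.mulVec_mulVec] using
        hS j (Pi.single i 1)
  rw [hf.map_directSum m n X X' hX hX', commute_shear_directSum_iff] at hcomm
  simp only [Matrix.toLin'_apply, Matrix.mulVec_mulVec, hcomm]

lemma exists_intertwines_extOp (hadm : IsRightAdmissible Ω) {X : Point k g m} {X' : Point k g n}
    (hX : X ∈ Ω m) (hX' : X' ∈ Ω n) (Z : Fin g → (Fin n → k) →ₗ[k] (Fin m → k)) :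
    ∃ X₁ ∈ Ω (m + n), ∃ e : ((Fin m → k) × (Fin n → k)) ≃ₗ[k] (Fin (m + n) → k),
      Intertwines (extOp (pointOp X) Z (pointOp X')) (pointOp X₁) e.toLinearMap := by
  obtain ⟨α, hα, hmem⟩ := hadm m n X X' (fun j => LinearMap.toMatrix' (Z j)) hX hX'
  let scale := (LinearEquiv.smulOfNeZero k (Fin m → k) α hα).prodCongr
    (LinearEquiv.refl k (Fin n → k))
  have hscale : Intertwines (extOp (pointOp X) Z (pointOp X')) (extOp (pointOp X)
      (fun j => (α • LinearMap.toMatrix' (Z j)).mulVecLin) (pointOp X')) scale.toLinearMap := by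
    intro j v
    simp [scale, LinearMap.toMatrix'_mulVec]
  exact ⟨_, hmem, scale.trans (stack k m n), (intertwines_stack X _ X').comp hscale⟩

end NCFunctions

section Resolvability

variable {k W W' : Type*} [Field k] [AddCommGroup W] [Module k W] [AddCommGroup W'] [Module k W']
  {g : ℕ} {Ω : ∀ n : ℕ, Set (Point k g n)} {X : Fin g → Module.End k W}
  {X' : Fin g → Module.End k W'}

variable (Ω X) in
/-- Every invariant subspace of `X` is the kernel of an intertwiner from `X` to a point of `Ω`.
Nc functions on `Ω` respect such kernels, which is how they are compared with polynomials. -/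
def IsResolvable : Prop :=
  ∀ U : Submodule k W, IsInvariant X U → ∃ (n : ℕ), ∃ X₁ ∈ Ω n, ∃ S : W →ₗ[k] (Fin n → k),
    Intertwines X (pointOp X₁) S ∧ LinearMap.ker S = U

lemma IsResolvable.congr (h : IsResolvable Ω X') (e : W ≃ₗ[k] W')
    (he : Intertwines X X' e.toLinearMap) : IsResolvable Ω X := by
  intro U hU
  obtain ⟨n, X₁, hX₁, S, hS, hker⟩ := h (U.map e.toLinearMap) (by
    rintro j _ ⟨w, hw, rfl⟩
    exact ⟨X j w, hU j w hw, he j w⟩)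
  refine ⟨n, X₁, hX₁, S ∘ₗ e.toLinearMap, hS.comp he, ?_⟩
  rw [LinearMap.ker_comp, hker]
  exact Submodule.comap_map_eq_of_injective e.injective U

lemma IsResolvable.extOp (hadm : IsRightAdmissible Ω) (h : IsResolvable Ω X)
    (h' : IsResolvable Ω X') (Z : Fin g → W' →ₗ[k] W) : IsResolvable Ω (extOp X Z X') := by
  intro U hU
  obtain ⟨m, X₁, hX₁, S₁, hI₁, hS₁⟩ := h (U.comap (LinearMap.inl k W W'))
    (fun j w hw => by simpa using hU j _ hw)
  obtain ⟨n, X₂, hX₂, S₂, hI₂, hS₂⟩ := h' (U.map (LinearMap.snd k W W')) (by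
    rintro j _ ⟨w, hw, rfl⟩
    exact ⟨_, hU j w hw, rfl⟩)
  obtain ⟨Z₁, S, hI, hS⟩ := exists_intertwines_extOp_ker_eq hU hI₁ hI₂ hS₁ hS₂
  obtain ⟨X₃, hX₃, e, he⟩ := exists_intertwines_extOp hadm hX₁ hX₂ Z₁
  exact ⟨m + n, X₃, hX₃, e.toLinearMap ∘ₗ S, he.comp hI, by rw [LinearEquiv.ker_comp, hS]⟩

lemma IsResolvable.exists_evalHom_mulVec_eq {n : ℕ} {X : Point k g n}
    {f : ∀ n : ℕ, Point k g n → Matrix (Fin n) (Fin n) k} (hres : IsResolvable Ω (pointOp X))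
    (hΩ : IsNCSet Ω) (hf : IsNCFunction Ω f) (hX : X ∈ Ω n) (v : Fin n → k) :
    ∃ p, (evalHom X p).mulVec v = (f n X).mulVec v := by
  let orbit : Submodule k (Fin n → k) :=
    LinearMap.range ((LinearMap.applyₗ v) ∘ₗ (act (pointOp X)).toLinearMap)
  obtain ⟨n', X', hX', S, hS, hker⟩ := hres orbit (by
    rintro j _ ⟨p, rfl⟩
    exact ⟨FreeAlgebra.ι k j * p, by simp⟩)
  have hv : S v = 0 := hker.ge ⟨1, by simp⟩
  have hfv : (f n X).mulVec v ∈ LinearMap.ker S := by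
    rw [LinearMap.mem_ker, hf.intertwines hΩ hX hX' hS, hv, Matrix.mulVec_zero]
  obtain ⟨p, hp⟩ := hker.le hfv
  exact ⟨p, (evalHom_mulVec X p v).trans hp⟩

end Resolvability

section Interpolation

open OpModule

variable {k : Type*} [Field k] {g : ℕ} {Ω : ∀ n : ℕ, Set (Point k g n)}
  {f : ∀ n : ℕ, Point k g n → Matrix (Fin n) (Fin n) k}

lemma IsSemisimplePoint.isResolvable {s : ℕ} {Y : Point k g s} (hY : IsSemisimplePoint Y)
    (hYΩ : Y ∈ Ω s) : IsResolvable Ω (pointOp Y) := by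
  intro U hU
  have := hY.isSemisimpleModule
  obtain ⟨π, hπ⟩ := IsSemisimpleModule.extension_property (submoduleOf hU).subtype
    (submoduleOf hU).injective_subtype LinearMap.id
  let φ : PtMod Y →ₗ[FreeAlgebra k (Fin g)] PtMod Y :=
    LinearMap.id - (submoduleOf hU).subtype ∘ₗ π
  refine ⟨s, Y, hYΩ, toLin φ, intertwines_toLin φ, Submodule.ext fun w => ?_⟩
  have hφ : toLin φ w = 0 ↔ of (pointOp Y) w = (π (of (pointOp Y) w)).1 := sub_eq_zero
  rw [LinearMap.mem_ker, hφ, ← of_mem_submoduleOf hU]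
  exact ⟨fun h => h ▸ (π _).2, fun h => (congrArg Subtype.val (LinearMap.congr_fun hπ ⟨_, h⟩)).symm⟩

lemma isResolvable_chainOp (hadm : IsRightAdmissible Ω) {s : ℕ} {Y : Point k g s}
    (hY : IsResolvable Ω (pointOp Y)) {ℓ : ℕ} (Z : Fin ℓ → Point k g s) :
    IsResolvable Ω (chainOp Y Z) := by
  induction ℓ with
  | zero =>
    exact hY.congr (LinearEquiv.funUnique (Fin 1) k (Fin s → k)) (chainOp_last Y Z)
  | succ ℓ ih =>
    have hcons : Intertwines (extOp (pointOp Y) (fun j => pointOp (Z 0) j ∘ₗ LinearMap.proj 0)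
        (chainOp Y (Fin.tail Z))) (chainOp Y Z)
        (Fin.consLinearEquiv k fun _ : Fin (ℓ + 2) => Fin s → k).toLinearMap :=
      fun j w => (chainOp_cons Y Z j w.1 w.2).symm
    exact (hY.extOp hadm (ih (Fin.tail Z)) _).congr _ hcons.symm

lemma isResolvable_bidiag (hadm : IsRightAdmissible Ω) {s : ℕ} {Y : Point k g s}
    (hY : IsResolvable Ω (pointOp Y)) {ℓ : ℕ} (Z : Fin ℓ → Point k g s) :
    IsResolvable Ω (pointOp (bidiag Y Z)) :=
  (isResolvable_chainOp hadm hY Z).congr (blocks k s ℓ) (intertwines_blocks_bidiag Y Z)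

lemma exists_mem_exists_intertwines (hΩ : IsNCSet Ω) (hadm : IsRightAdmissible Ω) {ι : Type*}
    {n : ι → ℕ} {X : ∀ c, Point k g (n c)} (hX : ∀ c, X c ∈ Ω (n c))
    (hres : ∀ c, IsResolvable Ω (pointOp (X c))) (v : ∀ c, Fin (n c) → k) {t : Finset ι}
    (ht : t.Nonempty) :
    ∃ (N : ℕ), ∃ X₀ ∈ Ω N, IsResolvable Ω (pointOp X₀) ∧ ∃ v₀ : Fin N → k, ∀ c ∈ t,
      ∃ S : (Fin N → k) →ₗ[k] (Fin (n c) → k),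
        Intertwines (pointOp X₀) (pointOp (X c)) S ∧ S v₀ = v c := by
  induction ht using Finset.Nonempty.cons_induction with
  | singleton c =>
    refine ⟨n c, X c, hX c, hres c, v c, fun c' hc' => ?_⟩
    obtain rfl := Finset.mem_singleton.mp hc'
    exact ⟨LinearMap.id, fun _ _ => rfl, rfl⟩
  | cons c t _ _ ih =>
    obtain ⟨N, X₀, hX₀, hres₀, v₀, hv₀⟩ := ih
    have hsplit := (intertwines_stack (X c) 0 X₀).symm
    refine ⟨n c + N, upperBlock (X c) 0 X₀, hΩ _ _ _ _ (hX c) hX₀,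
      ((hres c).extOp hadm hres₀ _).congr _ hsplit, stack k (n c) N (v c, v₀), fun c' hc' => ?_⟩
    rcases Finset.mem_cons.mp hc' with rfl | hc'
    · have hfst : Intertwines (extOp (pointOp (X c')) (fun _ => Matrix.mulVecLin 0) (pointOp X₀))
          (pointOp (X c')) (LinearMap.fst k _ _) := fun j w => by simp
      exact ⟨_, hfst.comp hsplit, by simp⟩
    · obtain ⟨S, hS, hSv⟩ := hv₀ c' hc'
      have hsnd : Intertwines (extOp (pointOp (X c)) (fun _ => Matrix.mulVecLin 0) (pointOp X₀))
          (pointOp X₀) (LinearMap.snd k _ _) := fun _ _ => rfl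
      exact ⟨_, hS.comp (hsnd.comp hsplit), by simpa using hSv⟩

lemma exists_evalHom_mulVec_eq (hΩ : IsNCSet Ω) (hadm : IsRightAdmissible Ω)
    (hf : IsNCFunction Ω f) {ι : Type*} {n : ι → ℕ} {X : ∀ c, Point k g (n c)}
    (hX : ∀ c, X c ∈ Ω (n c)) (hres : ∀ c, IsResolvable Ω (pointOp (X c)))
    (v : ∀ c, Fin (n c) → k) (t : Finset ι) :
    ∃ p, ∀ c ∈ t, (evalHom (X c) p).mulVec (v c) = (f (n c) (X c)).mulVec (v c) := by
  rcases t.eq_empty_or_nonempty with rfl | ht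
  · exact ⟨0, by simp⟩
  obtain ⟨N, X₀, hX₀, hres₀, v₀, hv₀⟩ := exists_mem_exists_intertwines hΩ hadm hX hres v ht
  obtain ⟨p, hp⟩ := hres₀.exists_evalHom_mulVec_eq hΩ hf hX₀ v₀
  refine ⟨p, fun c hc => ?_⟩
  obtain ⟨S, hS, hSv⟩ := hv₀ c hc
  calc (evalHom (X c) p).mulVec (v c) = S ((evalHom X₀ p).mulVec v₀) := by
        rw [evalHom_mulVec, evalHom_mulVec, hS.map_act, hSv]
    _ = (f (n c) (X c)).mulVec (v c) := by rw [hp, hf.intertwines hΩ hX₀ (hX c) hS, hSv]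

lemma exists_forall_dual_apply_eq {A D ι : Type*} [AddCommGroup A] [Module k A] [AddCommGroup D]
    [Module k D] [Module.Finite k D] (Φ : A →ₗ[k] D) (φ : ι → Module.Dual k D) (b : ι → k)
    (h : ∀ t : Finset ι, ∃ a, ∀ c ∈ t, φ c (Φ a) = b c) : ∃ a, ∀ c, φ c (Φ a) = b c := by
  classical
  obtain ⟨t', ht', hspan⟩ := (Submodule.fg_span_iff_fg_span_finset_subset (R := k)
    (Set.range φ)).mp (IsNoetherian.noetherian _)
  obtain ⟨t, -, rfl⟩ := Finset.subset_set_image_iff.mp (Set.image_univ.symm ▸ ht')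
  obtain ⟨a, ha⟩ := h t
  refine ⟨a, fun c => ?_⟩
  obtain ⟨a', ha'⟩ := h (insert c t)
  have hle : Submodule.span k (t.image φ : Set (Module.Dual k D))
      ≤ LinearMap.ker (Module.Dual.eval k D (Φ a - Φ a')) := by
    refine Submodule.span_le.mpr fun ψ hψ => ?_
    obtain ⟨d, hd, rfl⟩ := Finset.mem_image.mp hψ
    simp [ha d hd, ha' d (Finset.mem_insert_of_mem hd)]
  have hc : φ c (Φ a - Φ a') = 0 := hle (hspan ▸ Submodule.subset_span ⟨c, rfl⟩)
  rw [← ha' c (Finset.mem_insert_self c t), ← sub_eq_zero, ← map_sub, hc]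

theorem exists_polyDiff_isNCDifferential (hΩ : IsNCSet Ω) (hadm : IsRightAdmissible Ω)
    (hf : IsNCFunction Ω f) {h : ℕ} {s : Fin h → ℕ} {Y : ∀ i, Point k g (s i)}
    (hYΩ : ∀ i, Y i ∈ Ω (s i)) (hY : ∀ i, IsSemisimplePoint (Y i)) (L : ℕ) :
    ∃ p, ∀ i, ∀ ℓ ≤ L, IsNCDifferential Ω f (Y i) (polyDiff (Y i) p ℓ) := by
  -- The conditions on `p`, one for each matrix entry of the value at each admissible bidiagonal
  -- point, are linear in the differentials of `p`, which range over a finite-dimensional space.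
  let ι := Σ (i : Fin h) (ℓ : Fin (L + 1)),
    {Z : Fin ℓ.val → Point k g (s i) // bidiag (Y i) Z ∈ Ω _} × Fin (s i) × Fin (s i)
  let D := ∀ (i : Fin h) (ℓ : Fin (L + 1)), MultiMap k g (s i) ℓ.val
  let diffs : FreeAlgebra k (Fin g) →ₗ[k] D :=
    LinearMap.pi fun i => LinearMap.pi fun ℓ => LinearMap.proj ℓ.val ∘ₗ polyDiff (Y i)
  let entry : ι → Module.Dual k D := fun ⟨i, ℓ, Z, a, b⟩ =>
    { toFun := fun T => T i ℓ Z.1 a b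
      map_add' := fun _ _ => rfl
      map_smul' := fun _ _ => rfl }
  have hfin : ∀ t : Finset ι, ∃ p, ∀ c ∈ t, entry c (diffs p)
      = topRight (f _ (bidiag (Y c.1) c.2.2.1.1)) c.2.2.2.1 c.2.2.2.2 := by
    intro t
    obtain ⟨p, hp⟩ := exists_evalHom_mulVec_eq hΩ hadm hf
      (X := fun c : ι => bidiag (Y c.1) c.2.2.1.1) (fun c => c.2.2.1.2)
      (fun c => isResolvable_bidiag hadm ((hY c.1).isResolvable (hYΩ c.1)) _)
      (fun c => (blocks k _ _).symm (Pi.single (Fin.last _) (Pi.single c.2.2.2.2 1))) t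
    refine ⟨p, ?_⟩
    rintro ⟨i, ℓ, Z, a, b⟩ hc
    calc polyDiff (Y i) p ℓ Z.1 a b
        = topRight (evalHom (bidiag (Y i) Z.1) p) a b :=
          congrFun₂ (isNCDifferential_polyDiff (Y i) p ℓ Z.1 trivial).symm a b
      _ = topRight (f _ (bidiag (Y i) Z.1)) a b := by
          rw [topRight_apply, topRight_apply, hp _ hc]
  obtain ⟨p, hp⟩ := exists_forall_dual_apply_eq diffs entry _ hfin
  exact ⟨p, fun i ℓ hℓ Z hZ => Matrix.ext fun a b =>
    (hp ⟨i, ⟨ℓ, Nat.lt_succ_of_le hℓ⟩, ⟨Z, hZ⟩, a, b⟩).symm⟩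

end Interpolation

end FreeNC

theorem theoremD_general {k : Type*} [Field k] (g : ℕ) :
    (∀ (h : ℕ) (s : Fin h → ℕ) (Y : ∀ i, FreeNC.Point k g (s i)),
      (∀ i, FreeNC.IsSemisimplePoint (Y i)) → FreeNC.Separated Y →
      ∀ (L : ℕ) (F : ∀ (i : Fin h) (ℓ : ℕ), FreeNC.MultiMap k g (s i) ℓ),
        (∀ i, FreeNC.TruncLAC (Y i) L (F i)) →
        ∃ p : FreeAlgebra k (Fin g), ∀ (i : Fin h) (ℓ : ℕ), ℓ ≤ L →
          FreeNC.IsNCDifferential (fun _ => Set.univ) (FreeNC.evalPoly p) (Y i) (F i ℓ)) ∧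
    (∀ (Ω : ∀ n : ℕ, Set (FreeNC.Point k g n))
      (f : ∀ n : ℕ, FreeNC.Point k g n → Matrix (Fin n) (Fin n) k),
      FreeNC.IsNCSet Ω → FreeNC.IsRightAdmissible Ω → FreeNC.IsNCFunction Ω f →
      ∀ (h : ℕ) (s : Fin h → ℕ) (Y : ∀ i, FreeNC.Point k g (s i)),
        (∀ i, Y i ∈ Ω (s i)) → (∀ i, FreeNC.IsSemisimplePoint (Y i)) →
        ∀ L : ℕ, ∃ p : FreeAlgebra k (Fin g), ∀ (i : Fin h) (ℓ : ℕ), ℓ ≤ L →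
          ∃ T : FreeNC.MultiMap k g (s i) ℓ,
            FreeNC.IsNCDifferential Ω f (Y i) T ∧
            FreeNC.IsNCDifferential (fun _ => Set.univ) (FreeNC.evalPoly p) (Y i) T) := by
  refine ⟨fun h s Y hY hsep L F hF => ?_, fun Ω f hΩ hadm hf h s Y hYΩ hY L => ?_⟩
  · obtain ⟨p, hp⟩ := FreeNC.exists_polyDiff_eq_of_separated hY hsep hF
    exact ⟨p, fun i ℓ hℓ => hp i ℓ hℓ ▸ FreeNC.isNCDifferential_polyDiff (Y i) p ℓ⟩
  · obtain ⟨p, hp⟩ := FreeNC.exists_polyDiff_isNCDifferential hΩ hadm hf hYΩ hY L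
    exact ⟨p, fun i ℓ hℓ => ⟨_, hp i ℓ hℓ, FreeNC.isNCDifferential_polyDiff (Y i) p ℓ⟩⟩

theorem theoremD {k : Type*} [Field k] [CharZero k] (g : ℕ) :
    (∀ (h : ℕ) (s : Fin h → ℕ) (Y : ∀ i, FreeNC.Point k g (s i)),
      (∀ i, FreeNC.IsSemisimplePoint (Y i)) → FreeNC.Separated Y →
      ∀ (L : ℕ) (F : ∀ (i : Fin h) (ℓ : ℕ), FreeNC.MultiMap k g (s i) ℓ),
        (∀ i, FreeNC.TruncLAC (Y i) L (F i)) →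
        ∃ p : FreeAlgebra k (Fin g), ∀ (i : Fin h) (ℓ : ℕ), ℓ ≤ L →
          FreeNC.IsNCDifferential (fun _ => Set.univ) (FreeNC.evalPoly p) (Y i) (F i ℓ)) ∧
    (∀ (Ω : ∀ n : ℕ, Set (FreeNC.Point k g n))
      (f : ∀ n : ℕ, FreeNC.Point k g n → Matrix (Fin n) (Fin n) k),
      FreeNC.IsNCSet Ω → FreeNC.IsRightAdmissible Ω → FreeNC.IsNCFunction Ω f →
      ∀ (h : ℕ) (s : Fin h → ℕ) (Y : ∀ i, FreeNC.Point k g (s i)),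
        (∀ i, Y i ∈ Ω (s i)) → (∀ i, FreeNC.IsSemisimplePoint (Y i)) →
        ∀ L : ℕ, ∃ p : FreeAlgebra k (Fin g), ∀ (i : Fin h) (ℓ : ℕ), ℓ ≤ L →
          ∃ T : FreeNC.MultiMap k g (s i) ℓ,
            FreeNC.IsNCDifferential Ω f (Y i) T ∧
            FreeNC.IsNCDifferential (fun _ => Set.univ) (FreeNC.evalPoly p) (Y i) T) :=
  theoremD_general g
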